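/- **Setting.** Let $d\ge 1$, let $p$ be a bounded probability density on $\mathbb{R}^d$, $\mu$ the measure with density $p$, and $t>0$. Let $L(s)=\overline{\{x: p(x)\ge s\}}$. The clusters $C^{(1)},\dots,C^{(m)}$ are the connected components of $L(t)$; they are finitely many, compact, and each $\partial C^{(i)}$ is a smooth $(d-1)$-dimensional submanifold with minimal curvature radius $\kappa^{(i)}>0$ (inverse of the largest absolute principal curvature, $\infty$ if there is no curvature). For $s>0$ let $C^{(i)}_-(s)$ be the connected component of $L(t-s)$ containing $C^{(i)}$. Fix $\tilde\varepsilon>0$, $u^{(i)}>0$, $\rho^{(i)}>0$ with $\operatorname{dist}(C^{(i)}_-(2\tilde\varepsilon),C^{(j)}_-(2\tilde\varepsilon))\ge u^{(i)}$ for $j\ne i$ and $\rho^{(i)}\le\inf_{x\in C^{(i)}_-(2\tilde\varepsilon)}\mu(B(x,u^{(i)}))$. Put $\rho_{\min}=\min_j\rho^{(j)}$, $p^{(i)}_{\max}=\sup_{C^{(i)}}p$, $\beta_{(i)}=\mu(C^{(i)})$, and let $\eta_d$ be the volume of the unit ball. With $Col^{(i)}(\nu)=\{x\in C^{(i)}:\operatorname{dist}(x,\partial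 C^{(i)})\le\nu\}$, let $\nu^{(i)}_{\max}$ be the supremum of all $\nu\in(0,\kappa^{(i)}]$, $\nu<\infty$, such that $C^{(i)}\setminus Col^{(i)}(\nu)$ is non-empty and connected and every point of $C^{(i)}$ has distance at most $\nu$ from $C^{(i)}\setminus Col^{(i)}(\nu)$ (it is $0$ if there is no such $\nu$). Let $X_1,\dots,X_n$ be i.i.d. from $\mu$. In $G_{\rm sym}(n,k)$, $X_a$ and $X_b$ are adjacent if one of them is among the $k$ nearest neighbours of the other. $C^{(i)}$ is *identified* in a graph on the sample if the sample points in $C^{(i)}$ are connected to each other in the graph and not connected to points of any other cluster. For a density estimate $\hat p_n$, $\tilde G_{\rm sym}(n,k,s,\delta)$ arises from $G_{\rm sym}(n,k)$ by removing all points with $\hat p_n(X_a)<s$ and then all connected components with fewer than $\delta n$ points. $C^{(i)}$ is *roughly identified* in it if all sample points of $C^{(i)}$ are vertices, these are connected to each other, and every connected component of the graph contains points of exactly one cluster (and possibly points outside $L(t)$). An integer $k$ is called *admissible* (for $i$, $n$) if $$k\ge 4^{d+1}\tfrac{p^{(i)}_{\max}}{t}\log\bigl(2\cdot 8^d p^{(i)}_{\max}\operatorname{vol}(C^{(i)})\,n\bigr),\qquad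 k\le\tfrac{(n-1)\rho_{\min}}2-2\log n,$$ $$k\le (n-1)\,2\cdot4^d\eta_d\,p^{(i)}_{\max}\min\{(u^{(i)})^d,(\nu^{(i)}_{\max})^d\}.$$ Let $$\Gamma^{(i)}=\frac{\rho_{\min}}{2+\frac1{4^d}\frac t{p^{(i)}_{\max}}},\qquad \Omega^{(i)}_{\rm noisefree}=\frac{\rho_{\min}}{2\cdot4^{d+1}\frac{p^{(i)}_{\max}}t+4},\qquad E_n(k)=\min\Bigl\{\tfrac{n-1}2\bigl(\tfrac{\rho_{\min}}2-\tfrac{k-1}{n-1}\bigr),\ \tfrac{k-1}{4^{d+1}}\tfrac t{p^{(i)}_{\max}}\Bigr\}.$$ **Theorem.** 1. (Optimal $k$.) For $n\ge2$, over real $k$, the exponent $E_n(k)$ has the unique maximizer $k^*=(n-1)\Gamma^{(i)}+1$, and $E_n(k^*)=(n-1)\Omega^{(i)}_{\rm noisefree}$. 2. (Noise-free case.) Assume $p=0$ outside $L(t)$ and $p\ge t$ almost everywhere on $L(t)$. Then for all sufficiently large $n$: for every admissible $k$, $C^{(i)}$ is identified in $G_{\rm sym}(n,k)$ with probability at least $1-(m+2)e^{-E_n(k)}$;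 and if $k=\lfloor (n-1)\Gamma^{(i)}+1\rfloor$ is admissible, with probability at least $1-(m+2)e^{-(n-1)\Omega^{(i)}_{\rm noisefree}}$. 3. (Noisy case.) Assume $p$ is three times continuously differentiable with uniformly bounded derivatives and let $\hat p_n$ be the kernel density estimator with bandwidth $h>0$ for a bounded symmetric kernel with integral one and finite second moment. There are constants $C_1,C_2>0$, depending only on $p$ and the kernel, such that the following holds whenever $\delta>0$, $\beta_{(i)}>2\delta$, $0<\varepsilon\le\tilde\varepsilon$, $\mu\bigl(\bigcup_j(C^{(j)}_-(2\varepsilon)\setminus C^{(j)})\bigr)\le\delta/2$, every connected component of $L(t-2\varepsilon)$ contains a cluster, and $h^2\le C_1\varepsilon$. Let $$\Omega^{(i)}_{\rm noisy}=\min\Bigl\{\Omega^{(i)}_{\rm noisefree},\ \tfrac n{n-1}\tfrac\delta8,\ \tfrac n{n-1}C_2h^d\varepsilon^2\Bigr\}.$$ For all sufficiently large $n$: for every admissible $k$, $C^{(i)}$ is roughly identified in $\tilde G_{\rm sym}(n,k,t-\varepsilon,\delta)$ with probability at least $1-(m+7)e^{-\min\{E_n(k),\,n\delta/8,\,C_2nh^d\varepsilon^2\}}$;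 and if $k=\lfloor(n-1)\Gamma^{(i)}+1\rfloor$ is admissible, with probability at least $1-(m+7)e^{-(n-1)\Omega^{(i)}_{\rm noisy}}$. -/

import Mathlib

open MeasureTheory Metric Set
open scoped ENNReal ContDiff

noncomputable section

namespace KNNCluster

/-- Points of `ℝ^d` with the Euclidean distance. -/
abbrev Pt (d : ℕ) : Type := EuclideanSpace ℝ (Fin d)

/-! ### Densities and level sets -/

/-- `p` is a bounded probability density with respect to Lebesgue measure. -/
structure IsBoundedDensity {d : ℕ} (p : Pt d → ℝ) : Prop where
  measurable : Measurable p
  nonneg : ∀ x, 0 ≤ p x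
  bounded : ∃ B : ℝ, ∀ x, p x ≤ B
  total_mass : ∫⁻ x, ENNReal.ofReal (p x) = 1

/-- The measure `μ` on `ℝ^d` with density `p`. -/
def densityMeasure {d : ℕ} (p : Pt d → ℝ) : Measure (Pt d) :=
  volume.withDensity (fun x => ENNReal.ofReal (p x))

/-- The law of an i.i.d. sample of size `n` from the density `p`. -/
def sampleLaw {d : ℕ} (p : Pt d → ℝ) (n : ℕ) : Measure (Fin n → Pt d) :=
  Measure.pi (fun _ : Fin n => densityMeasure p)

/-- The level set `L(s)`, the closure of `{p ≥ s}`. -/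
def levelSet {d : ℕ} (p : Pt d → ℝ) (s : ℝ) : Set (Pt d) :=
  closure {x | s ≤ p x}

/-- For a cluster `A` of `L(t)`: the connected component of `L(t - s)` that contains `A`.
All points of the connected set `A` have the same component. -/
def enlarged {d : ℕ} (p : Pt d → ℝ) (t : ℝ) (A : Set (Pt d)) (s : ℝ) : Set (Pt d) :=
  ⋃ x ∈ A, connectedComponentIn (levelSet p (t - s)) x

/-! ### Geometry of the clusters -/

/-- `g` is a smooth local equation of the hypersurface `S` on the open neighbourhood `U` of `x`. -/
structure IsLocalEquation {d : ℕ} (S : Set (Pt d)) (x : Pt d) (U : Set (Pt d))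
    (g : Pt d → ℝ) : Prop where
  isOpen : IsOpen U
  mem : x ∈ U
  smooth : ContDiffOn ℝ ∞ g U
  regular : ∀ y ∈ U, fderiv ℝ g y ≠ 0
  zero_set : S ∩ U = {y | y ∈ U ∧ g y = 0}

/-- `S` is a smooth `(d-1)`-dimensional embedded submanifold of `ℝ^d`. -/
def IsSmoothHypersurface {d : ℕ} (S : Set (Pt d)) : Prop :=
  ∀ x ∈ S, ∃ U g, IsLocalEquation S x U g

/-- The absolute normal curvatures `|II_x(v, v)| = |D²g(x)(v, v)| / ‖Dg(x)‖` of `S`, over all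
points `x` of `S` and all unit tangent vectors `v` at `x`; they do not depend on the choice of
`g`. Their supremum is the largest absolute value of a principal curvature. -/
def normalCurvatures {d : ℕ} (S : Set (Pt d)) : Set ℝ :=
  {c | ∃ x ∈ S, ∃ U g, IsLocalEquation S x U g ∧ ∃ v : Pt d, ‖v‖ = 1 ∧ fderiv ℝ g x v = 0 ∧
    c = |fderiv ℝ (fderiv ℝ g) x v v| / ‖fderiv ℝ g x‖}

/-- The minimal curvature radius, the inverse of the largest principal curvature
(it is `∞` if all the principal curvatures vanish, in particular for `d = 1`). -/
def curvatureRadius {d : ℕ} (S : Set (Pt d)) : ℝ≥0∞ :=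
  (⨆ c ∈ normalCurvatures S, ENNReal.ofReal c)⁻¹

/-- The collar `Col(ν)` of the set `A`. -/
def collar {d : ℕ} (A : Set (Pt d)) (ν : ℝ) : Set (Pt d) :=
  {x | x ∈ A ∧ infDist x (frontier A) ≤ ν}

/-- The maximal covering radius `ν_max` of `A`: the largest `ν`, not larger than the minimal
curvature radius of the boundary, such that the inner part `A \ Col(ν)` is connected
(and non-empty) and every point of `A` has distance at most `ν` from that inner part. -/
def coveringRadius {d : ℕ} (A : Set (Pt d)) : ℝ :=
  sSup {ν : ℝ | 0 < ν ∧ ENNReal.ofReal ν ≤ curvatureRadius (frontier A) ∧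
    IsConnected (A \ collar A ν) ∧ ∀ x ∈ A, infDist x (A \ collar A ν) ≤ ν}

/-- A level `t`, the clusters `C i` of the density `p` at this level, and the parameters
`epsTilde`, `u i`, `ρ i`, with the standing assumptions on them. -/
structure ClusterModel {d : ℕ} (p : Pt d → ℝ) where
  /-- the level -/
  t : ℝ
  /-- the number of clusters -/
  m : ℕ
  /-- the clusters -/
  C : Fin m → Set (Pt d)
  /-- the enlarged clusters are components of the level set `L(t - 2 epsTilde)` -/
  epsTilde : ℝ
  /-- lower bounds for the distance of an enlarged cluster to the other ones -/
  u : Fin m → ℝ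
  /-- lower bounds for the mass of balls of radius `u i` around points of an enlarged cluster -/
  ρ : Fin m → ℝ
  t_pos : 0 < t
  C_injective : Function.Injective C
  range_C : Set.range C = {A | ∃ x ∈ levelSet p t, A = connectedComponentIn (levelSet p t) x}
  isCompact_C : ∀ i, IsCompact (C i)
  smooth_frontier : ∀ i, IsSmoothHypersurface (frontier (C i))
  curvatureRadius_pos : ∀ i, 0 < curvatureRadius (frontier (C i))
  epsTilde_pos : 0 < epsTilde
  u_pos : ∀ i, 0 < u i
  separated : ∀ i j, i ≠ j → ∀ x ∈ enlarged p t (C i) (2 * epsTilde),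
    ∀ y ∈ enlarged p t (C j) (2 * epsTilde), u i ≤ dist x y
  ρ_pos : ∀ i, 0 < ρ i
  ρ_le : ∀ i, ∀ x ∈ enlarged p t (C i) (2 * epsTilde),
    ρ i ≤ (densityMeasure p).real (ball x (u i))

namespace ClusterModel

variable {d : ℕ} {p : Pt d → ℝ}

/-- The noise-free case: the density vanishes outside the clusters and is at least `t` on them. -/
def NoiseFree (M : ClusterModel p) : Prop :=
  (∀ x, x ∉ levelSet p M.t → p x = 0) ∧ ∀ᵐ x, x ∈ levelSet p M.t → M.t ≤ p x

/-- The maximal density in the cluster `C i`. -/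
def pMax (M : ClusterModel p) (i : Fin M.m) : ℝ := sSup (p '' M.C i)

/-- The minimum of all the `ρ j`. -/
def rhoMin (M : ClusterModel p) : ℝ := ⨅ j, M.ρ j

/-- The volume `η_d` of the unit ball of `ℝ^d`. -/
def unitBallVolume (d : ℕ) : ℝ := (volume : Measure (Pt d)).real (ball 0 1)

/-- The lower and upper bounds on the number `k` of neighbours for the cluster `C i`
in the symmetric graph. -/
def NeighbourBounds (M : ClusterModel p) (i : Fin M.m) (n k : ℕ) : Prop :=
  4 ^ (d + 1) * (M.pMax i / M.t) *
      Real.log (2 * 8 ^ d * M.pMax i * (volume : Measure (Pt d)).real (M.C i) * n) ≤ (k : ℝ) ∧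
  (k : ℝ) ≤ ((n : ℝ) - 1) * M.rhoMin / 2 - 2 * Real.log n ∧
  (k : ℝ) ≤ ((n : ℝ) - 1) *
    (2 * 4 ^ d * unitBallVolume d * M.pMax i * min (M.u i ^ d) (coveringRadius (M.C i) ^ d))

/-- `Γ` -/
def Gam (M : ClusterModel p) (i : Fin M.m) : ℝ :=
  M.rhoMin / (2 + 1 / 4 ^ d * (M.t / M.pMax i))

/-- `Ω_noisefree` -/
def OmegaNoiseFree (M : ClusterModel p) (i : Fin M.m) : ℝ :=
  M.rhoMin / (2 * 4 ^ (d + 1) * (M.pMax i / M.t) + 4)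

/-- `Ω_noisy` -/
def OmegaNoisy (M : ClusterModel p) (i : Fin M.m) (n : ℕ) (δ h ε C₂ : ℝ) : ℝ :=
  min (min (M.OmegaNoiseFree i) ((n : ℝ) / ((n : ℝ) - 1) * (δ / 8)))
    ((n : ℝ) / ((n : ℝ) - 1) * (C₂ * h ^ d * ε ^ 2))

/-- The optimal number of neighbours as a real number, `(n - 1) Γ + 1`. -/
def kOpt (M : ClusterModel p) (i : Fin M.m) (n : ℕ) : ℝ := ((n : ℝ) - 1) * M.Gam i + 1

/-- The exponent of the error bound for a number `k` of neighbours: the smaller one of the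
exponents for between-cluster and for within-cluster connectivity. -/
def exponent (M : ClusterModel p) (i : Fin M.m) (n : ℕ) (k : ℝ) : ℝ :=
  min (((n : ℝ) - 1) / 2 * (M.rhoMin / 2 - (k - 1) / ((n : ℝ) - 1)))
    ((k - 1) / 4 ^ (d + 1) * (M.t / M.pMax i))

end ClusterModel

/-! ### Neighbourhood graphs on a sample -/

/-- `x i` is one of the `k` nearest neighbours of `x j` among the other sample points: fewer than
`k` of them are closer to `x j`. (Ties have probability zero.) -/
def IsKNN {d n : ℕ} (k : ℕ) (x : Fin n → Pt d) (i j : Fin n) : Prop :=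
  i ≠ j ∧ {l : Fin n | l ≠ j ∧ dist (x l) (x j) < dist (x i) (x j)}.ncard < k

/-- The symmetric `k`-nearest-neighbour graph `G_sym(n, k)`. -/
def symGraph {d n : ℕ} (k : ℕ) (x : Fin n → Pt d) : SimpleGraph (Fin n) where
  Adj i j := IsKNN k x i j ∨ IsKNN k x j i
  symm := ⟨fun _ _ h => Or.symm h⟩
  loopless := ⟨fun _ h => h.elim (fun h => h.1 rfl) (fun h => h.1 rfl)⟩

/-- The cluster `C i` is identified in the graph `G` on the sample `x`. -/
def Identified {d n m : ℕ} (C : Fin m → Set (Pt d)) (i : Fin m) (x : Fin n → Pt d)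
    (G : SimpleGraph (Fin n)) : Prop :=
  (∀ a b, x a ∈ C i → x b ∈ C i → G.Reachable a b) ∧
  ∀ j, j ≠ i → ∀ a b, x a ∈ C i → x b ∈ C j → ¬ G.Reachable a b

/-- A bounded symmetric kernel with integral one and finite second moment. -/
structure IsKernel {d : ℕ} (K : Pt d → ℝ) : Prop where
  measurable : Measurable K
  bounded : ∃ B : ℝ, ∀ x, |K x| ≤ B
  symmetric : ∀ x, K (-x) = K x
  integrable : Integrable K
  integral_eq_one : ∫ x, K x = 1
  second_moment : Integrable (fun x => ‖x‖ ^ 2 * K x)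

/-- The kernel density estimate with kernel `K` and bandwidth `h` at the point `y`. -/
def kde {d n : ℕ} (K : Pt d → ℝ) (h : ℝ) (x : Fin n → Pt d) (y : Pt d) : ℝ :=
  1 / ((n : ℝ) * h ^ d) * ∑ i, K (h⁻¹ • (y - x i))

/-- The vertices of `G'(n, k, s)`: the sample points with estimated density at least `s`. -/
def keptVertices {d n : ℕ} (K : Pt d → ℝ) (h : ℝ) (s : ℝ) (x : Fin n → Pt d) : Set (Fin n) :=
  {a | s ≤ kde K h x (x a)}

/-- The vertices of `G̃`: those vertices of the graph induced by `G` on `V` whose connected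
component there has at least `δ n` elements. -/
def largeVertices {n : ℕ} (G : SimpleGraph (Fin n)) (V : Set (Fin n)) (δ : ℝ) : Set (Fin n) :=
  {a | ∃ ha : a ∈ V,
    δ * n ≤ ({b : V | (G.induce V).Reachable ⟨a, ha⟩ b}.ncard : ℝ)}

/-- The vertices of `G̃_sym(n, k, s, δ)`. -/
def tildeVertices {d n : ℕ} (K : Pt d → ℝ) (h : ℝ) (k : ℕ) (s δ : ℝ) (x : Fin n → Pt d) :
    Set (Fin n) :=
  largeVertices (symGraph k x) (keptVertices K h s x) δ

/-- The graph `G̃_sym(n, k, s, δ)`. -/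
def tildeSymGraph {d n : ℕ} (K : Pt d → ℝ) (h : ℝ) (k : ℕ) (s δ : ℝ) (x : Fin n → Pt d) :
    SimpleGraph (tildeVertices K h k s δ x) :=
  (symGraph k x).induce (tildeVertices K h k s δ x)

/-- The cluster `C i` is roughly identified in the graph `G`, whose vertices form a part `W` of
the sample `x`: all sample points of `C i` are vertices, they are connected to each other in `G`,
and every connected component of `G` contains points of exactly one cluster. -/
def RoughlyIdentified {d n m : ℕ} (C : Fin m → Set (Pt d)) (i : Fin m) (x : Fin n → Pt d)
    (W : Set (Fin n)) (G : SimpleGraph W) : Prop :=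
  (∀ a, x a ∈ C i → a ∈ W) ∧
  (∀ a b : W, x a ∈ C i → x b ∈ C i → G.Reachable a b) ∧
  ∀ c : G.ConnectedComponent, ∃! j : Fin m, ∃ a : W, G.connectedComponentMk a = c ∧ x a ∈ C j

/-- `p` is three times continuously differentiable with uniformly bounded derivatives. -/
def IsC3Bounded {d : ℕ} (p : Pt d → ℝ) : Prop :=
  ContDiff ℝ 3 p ∧ ∀ j : ℕ, j ≤ 3 → ∃ B : ℝ, ∀ x, ‖iteratedFDeriv ℝ j p x‖ ≤ B

/-- The remaining assumptions of the noisy case for the cluster `C i`: the cluster has mass more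
than `2 δ`, the level `ε` is at most `epsTilde` and so small that the boundary strips have mass
at most `δ / 2`; every component of `L(t - 2 ε)` contains a cluster. -/
def ClusterModel.NoisyAssumptions {d : ℕ} {p : Pt d → ℝ} (M : ClusterModel p) (i : Fin M.m)
    (δ ε : ℝ) : Prop :=
  0 < δ ∧ 0 < ε ∧ ε ≤ M.epsTilde ∧
  2 * δ < (densityMeasure p).real (M.C i) ∧
  (densityMeasure p).real (⋃ j, (enlarged p M.t (M.C j) (2 * ε) \ M.C j)) ≤ δ / 2 ∧
  levelSet p (M.t - 2 * ε) ⊆ ⋃ j, enlarged p M.t (M.C j) (2 * ε)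

end KNNCluster

end

/-! The cluster `C i` can fail to be identified for two reasons, and each failure has an
exponentially small probability by Chernoff bounds conditional on one sample point.

Between clusters: if every sample point in an enlarged cluster `j` has at least `k` other sample
points within `u j`, no edge joins it to another enlarged cluster, because a point there is at
distance at least `u j` and so is not among the `k` nearest (`eq_of_adj_of_not_sparseAt`). The
number of neighbours within `u j` is binomial with mean at least `(n - 1) * rhoMin`. The lower tail
has exponent `2 * E`, and the bound `k ≤ (n - 1) * rhoMin / 2 - 2 * log n` lets half of it pay for
the union over the `n` points. This leaves `m * exp (-E)` (`measure_sparseAt_le`).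

Within the cluster: choose `ν` such that the volume bound for a ball of radius `4 * ν` has expected
sample count at most `k / 2`. As `ν` is at most the covering radius, each ball of radius `2 * ν`
around a point of the cluster meets it in volume at least that of a ball of radius `ν`
(`le_volume_ball_inter`). Take a net of the cluster that is much finer than `ν`. If each ball of
radius `2 * ν` around a net point contains a sample point of the cluster, and no ball of radius
slightly above `4 * ν` around a sample point of the cluster contains `k` others, then connectedness
of the cluster links all its sample points through the net (`reachable_of_net`). A union bound gives
`2 * exp (-τ)` with `τ = k * (t / pMax) / 4 ^ (d + 1)` (`measure_not_connected_le`).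

The first exponent decreases and the second increases in `k`; equating them gives `kOpt`.

In the noisy case three more events enter. The density estimate is within `ε` of `p` at all sample
points (`kde_concentration`), so all cluster points survive and all survivors lie in the components
of level `t - 2 * ε`. At least `δ * n` sample points lie in `C i`, and fewer than `δ * n` in the
strips around the clusters. Hence the component of `C i` is kept, while a component without cluster
points is discarded (`roughlyIdentified_of_events`). -/

namespace KNNCluster

/-! ### Exponential Markov and Chernoff bounds for i.i.d. samples -/

section Tail

theorem prod_exp_indicator {E : Type*} {n : ℕ} (S : Finset (Fin n)) (x : Fin n → E) (B : Set E) (s : ℝ) :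
    ∏ l ∈ S, ENNReal.ofReal (Real.exp (s * B.indicator (fun _ => (1 : ℝ)) (x l))) =
      ENNReal.ofReal (Real.exp (s * ({l | l ∈ S ∧ x l ∈ B}.ncard : ℝ))) := by
  classical
  rw [← ENNReal.ofReal_prod_of_nonneg fun l _ => (Real.exp_pos _).le, ← Real.exp_sum,
    ← Finset.mul_sum]
  congr 4
  have : {l | l ∈ S ∧ x l ∈ B} = ((S.filter fun l => x l ∈ B : Finset (Fin n)) : Set (Fin n)) := by
    ext; simp
  rw [this, ncard_coe_finset, Finset.card_filter]
  push_cast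
  refine Finset.sum_congr rfl fun l _ => ?_
  by_cases h : x l ∈ B <;> simp [h]

variable {E : Type*} [MeasurableSpace E] (μ : Measure E) [IsProbabilityMeasure μ]

theorem lintegral_pi_succAbove {n : ℕ} (a : Fin (n + 1)) (F : E × (Fin n → E) → ℝ≥0∞)
    (hF : Measurable F) :
    ∫⁻ x, F (x a, fun l => x (a.succAbove l)) ∂(Measure.pi fun _ : Fin (n + 1) => μ) =
      ∫⁻ y, ∫⁻ x, F (y, x) ∂(Measure.pi fun _ : Fin n => μ) ∂μ := by
  have h := (measurePreserving_piFinSuccAbove (fun _ : Fin (n + 1) => μ) a).lintegral_comp hF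
  rw [lintegral_prod _ hF.aemeasurable] at h
  exact h

theorem lintegral_pi_prod (n : ℕ) (f : E → ℝ≥0∞) (hf : Measurable f) :
    ∫⁻ x, ∏ l, f (x l) ∂(Measure.pi fun _ : Fin n => μ) = (∫⁻ z, f z ∂μ) ^ n := by
  induction n with
  | zero => simp
  | succ n ih =>
    have h := lintegral_pi_succAbove μ (0 : Fin (n + 1)) (fun q => f q.1 * ∏ l, f (q.2 l))
      (by fun_prop)
    simp only [Fin.prod_univ_succAbove _ (0 : Fin (n + 1))]
    rw [h]
    have h2 : ∀ y, ∫⁻ x, f y * ∏ l, f (x l) ∂(Measure.pi fun _ : Fin n => μ) =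
        f y * (∫⁻ z, f z ∂μ) ^ n := fun y => by
      rw [lintegral_const_mul _ (by fun_prop), ih]
    simp only [h2]
    rw [lintegral_mul_const _ hf, pow_succ']

/-- Markov's inequality for a product of functions of independent coordinates, whose integral
factorises. The set `A` need not be measurable. -/
theorem pi_le_mul_pow (n : ℕ) (f : E → ℝ≥0∞) (hf : Measurable f) (c : ℝ≥0∞)
    (A : Set (Fin n → E)) (hA : ∀ x ∈ A, 1 ≤ c * ∏ l, f (x l)) :
    Measure.pi (fun _ : Fin n => μ) A ≤ c * (∫⁻ z, f z ∂μ) ^ n := by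
  have hm : Measurable fun x : Fin n → E => c * ∏ l, f (x l) := by fun_prop
  have h := mul_meas_ge_le_lintegral (μ := Measure.pi fun _ : Fin n => μ) hm 1
  rw [one_mul, lintegral_const_mul _ (by fun_prop), lintegral_pi_prod μ n f hf] at h
  exact (measure_mono fun x hx => hA x hx).trans h

/-- Markov's inequality again, after conditioning on the coordinate `a` by Fubini: given its value,
the other `n - 1` coordinates are still i.i.d. This handles counts and kernel sums centred at a
sample point. -/
theorem pi_le_lintegral_mul_pow (n : ℕ) (a : Fin n) (f : E → E → ℝ≥0∞)
    (hf : Measurable (Function.uncurry f)) (g : E → ℝ≥0∞) (hg : Measurable g)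
    (A : Set (Fin n → E)) (hA : ∀ x ∈ A, 1 ≤ g (x a) * ∏ l ∈ Finset.univ.erase a, f (x a) (x l)) :
    Measure.pi (fun _ : Fin n => μ) A ≤ ∫⁻ y, g y * (∫⁻ z, f y z ∂μ) ^ (n - 1) ∂μ := by
  obtain ⟨n, rfl⟩ : ∃ N, n = N + 1 := ⟨n - 1, by have := a.pos; omega⟩
  have herase : ∀ φ : Fin (n + 1) → ℝ≥0∞, ∏ l ∈ Finset.univ.erase a, φ l =
      ∏ l : Fin n, φ (a.succAbove l) := fun φ => by
    rw [Fin.univ_succAbove n a]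
    simp
  have hF : Measurable fun q : E × (Fin n → E) => g q.1 * ∏ l, f q.1 (q.2 l) := by
    refine (hg.comp measurable_fst).mul (Finset.measurable_prod _ fun l _ => ?_)
    exact hf.comp (measurable_fst.prodMk ((measurable_pi_apply l).comp measurable_snd))
  have hm : Measurable fun x : Fin (n + 1) → E =>
      g (x a) * ∏ l, f (x a) (x (a.succAbove l)) :=
    have hp : Measurable fun x : Fin (n + 1) → E => (x a, fun l => x (a.succAbove l)) := by fun_prop
    hF.comp hp
  have h := mul_meas_ge_le_lintegral (μ := Measure.pi fun _ : Fin (n + 1) => μ) hm 1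
  rw [one_mul, lintegral_pi_succAbove μ a (fun q => g q.1 * ∏ l, f q.1 (q.2 l)) hF] at h
  refine (measure_mono fun x hx => ?_).trans (h.trans_eq ?_)
  · have := hA x hx
    rwa [herase] at this
  · refine lintegral_congr fun y => ?_
    have hy : Measurable (f y) := hf.comp measurable_prodMk_left
    rw [Nat.add_sub_cancel, ← lintegral_pi_prod μ n _ hy]
    have hy' : Measurable fun x : Fin n → E => ∏ l, f y (x l) := by fun_prop
    exact lintegral_const_mul (g y) hy'

theorem lintegral_exp_indicator_le (B : Set E) (hB : MeasurableSet B) (s b : ℝ)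
    (hb : (Real.exp s - 1) * μ.real B ≤ b) :
    ∫⁻ z, ENNReal.ofReal (Real.exp (s * B.indicator (fun _ => (1 : ℝ)) z)) ∂μ ≤
      ENNReal.ofReal (Real.exp b) := by
  have hpt : ∀ z, Real.exp (s * B.indicator (fun _ => (1 : ℝ)) z) =
      1 + B.indicator (fun _ => Real.exp s - 1) z := fun z => by
    by_cases hz : z ∈ B <;> simp [hz]
  have hint : Integrable (fun z => 1 + B.indicator (fun _ => Real.exp s - 1) z) μ :=
    (integrable_const _).add ((integrable_const _).indicator hB)
  rw [← ofReal_integral_eq_lintegral_ofReal (by simpa only [hpt] using hint)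
    (Filter.Eventually.of_forall fun z => (Real.exp_pos _).le)]
  simp only [hpt]
  rw [integral_add (integrable_const _) ((integrable_const _).indicator hB),
    integral_indicator_const _ hB]
  refine ENNReal.ofReal_le_ofReal ?_
  have := Real.add_one_le_exp b
  simp only [integral_const, probReal_univ, smul_eq_mul]
  linarith

theorem real_le_of_le_ofReal {α : Type*} [MeasurableSpace α] {ν : Measure α} {A : Set α} {b : ℝ}
    (hb : 0 ≤ b) (h : ν A ≤ ENNReal.ofReal b) : ν.real A ≤ b :=
  ENNReal.toReal_le_of_le_ofReal hb h

/-- Chernoff's bound for the number of sample points in a set, in both directions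
(`s` may be negative). -/
theorem pi_count_tail (n : ℕ) (B : Set E) (hB : MeasurableSet B) (s b c : ℝ)
    (hb : (Real.exp s - 1) * μ.real B ≤ b) (A : Set (Fin n → E))
    (hA : ∀ x ∈ A, c ≤ s * ({l | x l ∈ B}.ncard : ℝ)) :
    (Measure.pi (fun _ : Fin n => μ)).real A ≤ Real.exp (n * b - c) := by
  refine real_le_of_le_ofReal (Real.exp_pos _).le ?_
  have hmi : Measurable fun z => ENNReal.ofReal
      (Real.exp (s * B.indicator (fun _ => (1 : ℝ)) z)) :=
    (Real.measurable_exp.comp ((measurable_const.indicator hB).const_mul s)).ennreal_ofReal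
  refine (pi_le_mul_pow μ n _ hmi (ENNReal.ofReal (Real.exp (-c))) A fun x hx => ?_).trans ?_
  · rw [prod_exp_indicator, ← ENNReal.ofReal_mul (Real.exp_pos _).le, ← Real.exp_add,
      ENNReal.one_le_ofReal, Real.one_le_exp_iff]
    have := hA x hx
    simp only [Finset.mem_univ, true_and]
    linarith
  · refine (mul_le_mul_right (pow_le_pow_left' (lintegral_exp_indicator_le μ B hB s b hb) n) _).trans ?_
    rw [← ENNReal.ofReal_pow (Real.exp_pos _).le, ← ENNReal.ofReal_mul (Real.exp_pos _).le,
      ← Real.exp_nat_mul, ← Real.exp_add]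
    exact ENNReal.ofReal_le_ofReal (Real.exp_le_exp.2 (by linarith))

/-- Chernoff's bound for the number of the other sample points that are related to the point with
index `a`. -/
theorem pi_count_tail_at (n : ℕ) (a : Fin n) (T : Set (E × E)) (hT : MeasurableSet T)
    (D : Set E) (hD : MeasurableSet D) (s b c : ℝ)
    (hb : ∀ y ∈ D, (Real.exp s - 1) * μ.real {z | (y, z) ∈ T} ≤ b) (A : Set (Fin n → E))
    (hA : ∀ x ∈ A, x a ∈ D ∧ c ≤ s * ({l | l ≠ a ∧ (x a, x l) ∈ T}.ncard : ℝ)) :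
    (Measure.pi (fun _ : Fin n => μ)).real A ≤
      μ.real D * Real.exp (((n : ℝ) - 1) * b - c) := by
  have hTy : ∀ y, MeasurableSet {z | (y, z) ∈ T} := fun y => measurable_prodMk_left hT
  refine real_le_of_le_ofReal (mul_nonneg measureReal_nonneg (Real.exp_pos _).le) ?_
  have hm : Measurable (Function.uncurry fun y z => ENNReal.ofReal
      (Real.exp (s * {z | (y, z) ∈ T}.indicator (fun _ => (1 : ℝ)) z))) := by
    have : (Function.uncurry fun y z => ENNReal.ofReal
      (Real.exp (s * {z | (y, z) ∈ T}.indicator (fun _ => (1 : ℝ)) z))) =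
      fun q => ENNReal.ofReal (Real.exp (s * T.indicator (fun _ => (1 : ℝ)) q)) := by
      ext ⟨y, z⟩
      simp [Function.uncurry, indicator]
    rw [this]
    exact (Real.measurable_exp.comp ((measurable_const.indicator hT).const_mul s)).ennreal_ofReal
  refine (pi_le_lintegral_mul_pow μ n a _ hm
    (D.indicator fun _ => ENNReal.ofReal (Real.exp (-c))) (measurable_const.indicator hD) A
    fun x hx => ?_).trans ?_
  · obtain ⟨h1, h2⟩ := hA x hx
    rw [prod_exp_indicator, indicator_of_mem h1, ← ENNReal.ofReal_mul (Real.exp_pos _).le,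
      ← Real.exp_add, ENNReal.one_le_ofReal, Real.one_le_exp_iff]
    simp only [Finset.mem_erase, Finset.mem_univ, and_true, mem_ofPred_eq]
    linarith
  · have hn : ((n - 1 : ℕ) : ℝ) = (n : ℝ) - 1 := by
      rw [Nat.cast_sub (by have := a.pos; omega)]; simp
    calc _ ≤ ∫⁻ y, D.indicator (fun _ => ENNReal.ofReal (Real.exp (((n : ℝ) - 1) * b - c))) y ∂μ := by
          refine lintegral_mono fun y => ?_
          by_cases hy : y ∈ D
          · simp only [indicator_of_mem hy]
            refine (mul_le_mul_right (pow_le_pow_left'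
              (lintegral_exp_indicator_le μ _ (hTy y) s b (hb y hy)) (n - 1)) _).trans ?_
            rw [← ENNReal.ofReal_pow (Real.exp_pos _).le, ← ENNReal.ofReal_mul (Real.exp_pos _).le,
              ← Real.exp_nat_mul, ← Real.exp_add, hn]
            exact ENNReal.ofReal_le_ofReal (Real.exp_le_exp.2 (by linarith))
          · simp [hy]
      _ = _ := by
          rw [lintegral_indicator_const hD, ENNReal.ofReal_mul measureReal_nonneg,
            ofReal_measureReal, mul_comm]

theorem pi_avoid_le (n : ℕ) (B : Set E) (hB : MeasurableSet B) (b : ℝ) (hb : b ≤ μ.real B) :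
    (Measure.pi (fun _ : Fin n => μ)).real {x | ∀ l, x l ∉ B} ≤ Real.exp (-(n * b)) := by
  have : {x : Fin n → E | ∀ l, x l ∉ B} = univ.pi fun _ => Bᶜ := by ext; simp
  rw [this, measureReal_def, Measure.pi_pi]
  simp only [Finset.prod_const, Finset.card_univ, Fintype.card_fin, ENNReal.toReal_pow]
  rw [← measureReal_def, probReal_compl_eq_one_sub hB]
  have h1 : 1 - μ.real B ≤ Real.exp (-b) := by
    have := Real.add_one_le_exp (-b); linarith
  calc _ ≤ Real.exp (-b) ^ n := pow_le_pow_left₀ (by linarith [measureReal_le_one (μ := μ) (s := B)]) h1 n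
    _ = _ := by rw [← Real.exp_nat_mul]; ring_nf

/-- Only monotonicity and subadditivity are used, so neither the good event nor the bad one has to
be shown measurable. -/
theorem one_sub_le_measureReal {α : Type*} [MeasurableSpace α] {ν : Measure α}
    [IsProbabilityMeasure ν] {A B : Set α} {b : ℝ} (hAB : ∀ᵐ x ∂ν, x ∉ B → x ∈ A)
    (hb : ν.real B ≤ b) :
    1 - b ≤ ν.real A := by
  have h0 : ν.real {x | ¬ (x ∉ B → x ∈ A)} = 0 := by
    rw [measureReal_def, ae_iff.1 hAB]; rfl
  have h1 : ν.real univ ≤ ν.real (A ∪ B ∪ {x | ¬ (x ∉ B → x ∈ A)}) := by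
    refine measureReal_mono (fun x _ => ?_) (measure_ne_top _ _)
    simp only [mem_union, mem_ofPred_eq]
    tauto
  have h2 := measureReal_union_le (μ := ν) (A ∪ B) {x | ¬ (x ∉ B → x ∈ A)}
  have h3 := measureReal_union_le (μ := ν) A B
  rw [probReal_univ] at h1
  linarith

end Tail

/-! ### Mass bounds from density bounds, and level sets -/

section Density

variable {d : ℕ} {p : Pt d → ℝ}

theorem IsBoundedDensity.isProbabilityMeasure (hp : IsBoundedDensity p) :
    IsProbabilityMeasure (densityMeasure p) := by
  refine ⟨?_⟩
  rw [densityMeasure, withDensity_apply _ MeasurableSet.univ, setLIntegral_univ, hp.total_mass]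

theorem densityMeasure_apply_le {A : Set (Pt d)} {c : ℝ} (hA : MeasurableSet A)
    (h : ∀ x ∈ A, p x ≤ c) : densityMeasure p A ≤ ENNReal.ofReal c * volume A := by
  rw [densityMeasure, withDensity_apply _ hA]
  calc _ ≤ ∫⁻ _ in A, ENNReal.ofReal c :=
        setLIntegral_mono measurable_const fun x hx => ENNReal.ofReal_le_ofReal (h x hx)
    _ = _ := by rw [setLIntegral_const]

theorem densityMeasure_real_le {A : Set (Pt d)} {c : ℝ} (hc : 0 ≤ c) (hA : MeasurableSet A)
    (hfin : volume A ≠ ⊤) (h : ∀ x ∈ A, p x ≤ c) :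
    (densityMeasure p).real A ≤ c * (volume : Measure (Pt d)).real A := by
  have := ENNReal.toReal_mono (ENNReal.mul_ne_top ENNReal.ofReal_ne_top hfin)
    (densityMeasure_apply_le hA h)
  rwa [ENNReal.toReal_mul, ENNReal.toReal_ofReal hc] at this

theorem le_densityMeasure_real {A : Set (Pt d)} {c : ℝ} (hc : 0 ≤ c) (hA : MeasurableSet A)
    (hfin : densityMeasure p A ≠ ⊤) (h : ∀ᵐ x, x ∈ A → c ≤ p x) :
    c * (volume : Measure (Pt d)).real A ≤ (densityMeasure p).real A := by
  have h1 : ENNReal.ofReal c * volume A ≤ densityMeasure p A := by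
    rw [densityMeasure, withDensity_apply _ hA, ← setLIntegral_const]
    refine lintegral_mono_ae ?_
    rw [ae_restrict_iff' hA]
    filter_upwards [h] with x hx hxA using ENNReal.ofReal_le_ofReal (hx hxA)
  have := ENNReal.toReal_mono hfin h1
  rwa [ENNReal.toReal_mul, ENNReal.toReal_ofReal hc] at this

theorem volume_real_ball (hd : 0 < d) (x : Pt d) {r : ℝ} (hr : 0 ≤ r) :
    (volume : Measure (Pt d)).real (ball x r) = r ^ d * ClusterModel.unitBallVolume d := by
  have : Nonempty (Fin d) := ⟨⟨0, hd⟩⟩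
  rw [measureReal_def, Measure.addHaar_ball _ x hr, ENNReal.toReal_mul,
    ENNReal.toReal_ofReal (by positivity), ClusterModel.unitBallVolume, measureReal_def]
  simp

theorem unitBallVolume_pos (d : ℕ) : 0 < ClusterModel.unitBallVolume d :=
  ENNReal.toReal_pos (measure_ball_pos _ _ one_pos).ne' measure_ball_lt_top.ne

theorem levelSet_anti {s s' : ℝ} (h : s ≤ s') : levelSet p s' ⊆ levelSet p s :=
  closure_mono fun _ hx => le_trans h hx

theorem enlarged_mono {t s s' : ℝ} (A : Set (Pt d)) (h : s ≤ s') :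
    enlarged p t A s ⊆ enlarged p t A s' :=
  iUnion₂_mono fun x _ => connectedComponentIn_mono x (levelSet_anti (by linarith))

end Density

/-! ### Balls inside a cluster, from the covering radius -/

section InnerBall

variable {d : ℕ}

/-- The ball is connected and misses the frontier, so it cannot leave the interior. For an empty
frontier `infDist` is `0`, which makes the ball empty. -/
theorem ball_subset_of_le_infDist_frontier {A : Set (Pt d)} {y : Pt d} {r : ℝ} (hy : y ∈ A)
    (hr : r ≤ infDist y (frontier A)) : ball y r ⊆ A := by
  rcases le_or_gt r 0 with h0 | h0
  · rw [ball_eq_empty.2 h0]; exact empty_subset _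
  have hdis : ∀ z ∈ ball y r, z ∉ frontier A := fun z hz hzf => by
    have := infDist_le_dist_of_mem (x := y) hzf
    rw [mem_ball, dist_comm] at hz
    linarith
  have hint : ∀ z ∈ ball y r, z ∈ closure A → z ∈ interior A := fun z hz hzc => by
    by_contra hzi
    exact hdis z hz ⟨hzc, hzi⟩
  refine ((convex_ball y r).isPreconnected.subset_left_of_subset_union isOpen_interior
    (isClosed_closure (s := A)).isOpen_compl ?_ (fun z hz => ?_) ⟨y, mem_ball_self h0, ?_⟩).trans
    interior_subset
  · exact (disjoint_compl_right (a := closure A)).mono_left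
      (interior_subset.trans subset_closure)
  · by_cases hzc : z ∈ closure A
    · exact Or.inl (hint z hz hzc)
    · exact Or.inr hzc
  · exact hint y (mem_ball_self h0) (subset_closure hy)

/-- Below the covering radius, every point of `A` is close to the centre of a ball inside `A`. -/
theorem exists_inner_ball {A : Set (Pt d)} {ν ν' : ℝ} (h0 : 0 ≤ ν) (hν : ν < coveringRadius A)
    (hν' : ν < ν') {x : Pt d} (hx : x ∈ A) :
    ∃ w, dist w x + ν ≤ 2 * ν' ∧ ball w ν ⊆ A := by
  unfold coveringRadius at hν
  set S := {ν : ℝ | 0 < ν ∧ ENNReal.ofReal ν ≤ curvatureRadius (frontier A) ∧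
    IsConnected (A \ collar A ν) ∧ ∀ x ∈ A, infDist x (A \ collar A ν) ≤ ν} with hS
  have hne : S.Nonempty := by
    by_contra hcon
    rw [not_nonempty_iff_eq_empty.1 hcon, Real.sSup_empty] at hν
    linarith
  obtain ⟨ν₁, ⟨hpos, -, hconn, hcov⟩, hlt⟩ := exists_lt_of_lt_csSup hne hν
  -- The supremum in `coveringRadius` and the infimum in `infDist` need not be attained; the slack
  -- `η` pays for both.
  set η := 2 * ν' - 2 * ν with hη
  have hη0 : 0 < η := by linarith
  obtain ⟨y, hy, hxy⟩ := (infDist_lt_iff (x := x) (r := ν₁ + η) hconn.nonempty).1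
    (by linarith [hcov x hx])
  have hyA : y ∈ A := hy.1
  have hyf : ν₁ < infDist y (frontier A) := by
    by_contra hcon
    exact hy.2 ⟨hyA, not_lt.1 hcon⟩
  have hball := ball_subset_of_le_infDist_frontier hyA hyf.le
  rcases le_or_gt (dist x y) (ν + η) with hle | hgt
  · refine ⟨y, ?_, (ball_subset_ball hlt.le).trans hball⟩
    rw [dist_comm]; linarith
  -- If `y` is too far from `x`, move the centre from `y` towards `x` up to distance `ν + η` from
  -- `x`. It moves by less than `ν₁ - ν`, so the ball of radius `ν` stays in the ball of radius `ν₁`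
  -- around `y`.
  · have hd0 : 0 < dist x y := by linarith
    refine ⟨AffineMap.lineMap x y ((ν + η) / dist x y), ?_, ?_⟩
    · rw [dist_lineMap_left, Real.norm_of_nonneg (by positivity), div_mul_cancel₀ _ hd0.ne']
      linarith
    · refine (ball_subset_ball' ?_).trans hball
      rw [dist_lineMap_right, Real.norm_of_nonneg, sub_mul, div_mul_cancel₀ _ hd0.ne']
      · linarith
      · rw [sub_nonneg, div_le_one hd0]; exact hgt.le

/-- For radii `s < ν` an inner ball of radius `s` lies in `ball x (2 * ν) ∩ A`; letting `s` tend to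
`ν` covers the endpoint `ν = coveringRadius A` too. -/
theorem le_volume_ball_inter (hd : 0 < d) {A : Set (Pt d)} {ν : ℝ} (h0 : 0 ≤ ν)
    (hν : ν ≤ coveringRadius A) {x : Pt d} (hx : x ∈ A) :
    ClusterModel.unitBallVolume d * ν ^ d ≤ (volume : Measure (Pt d)).real (ball x (2 * ν) ∩ A) := by
  rcases h0.eq_or_lt with rfl | hpos
  · rw [zero_pow hd.ne', mul_zero]; exact measureReal_nonneg
  have hfin : volume (ball x (2 * ν) ∩ A) ≠ ⊤ :=
    ((measure_mono inter_subset_left).trans_lt measure_ball_lt_top).ne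
  have key : ∀ s ∈ Ico 0 ν, ClusterModel.unitBallVolume d * s ^ d ≤
      (volume : Measure (Pt d)).real (ball x (2 * ν) ∩ A) := fun s hs => by
    obtain ⟨w, hw, hwA⟩ := exists_inner_ball hs.1 (hs.2.trans_le hν) hs.2 hx
    rw [mul_comm, ← volume_real_ball hd w hs.1]
    refine measureReal_mono (subset_inter (ball_subset_ball' ?_) hwA) hfin
    linarith
  have hcont : Filter.Tendsto (fun s : ℝ => ClusterModel.unitBallVolume d * s ^ d)
      (nhdsWithin ν (Iio ν)) (nhds (ClusterModel.unitBallVolume d * ν ^ d)) :=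
    (Continuous.tendsto (by fun_prop) ν).mono_left nhdsWithin_le_nhds
  refine le_of_tendsto hcont ?_
  filter_upwards [Ico_mem_nhdsLT hpos] with s hs using key s hs

end InnerBall

/-! ### Elementary facts on clusters and their parameters -/

namespace ClusterModel

variable {d : ℕ} {p : Pt d → ℝ} (M : ClusterModel p)

theorem exists_C_eq (i : Fin M.m) : ∃ x ∈ levelSet p M.t, M.C i = connectedComponentIn (levelSet p M.t) x := by
  have : M.C i ∈ Set.range M.C := mem_range_self i
  rw [M.range_C] at this
  exact this

theorem C_nonempty (i : Fin M.m) : (M.C i).Nonempty := by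
  obtain ⟨x, hx, h⟩ := M.exists_C_eq i
  exact ⟨x, h ▸ mem_connectedComponentIn hx⟩

theorem C_subset (i : Fin M.m) : M.C i ⊆ levelSet p M.t := by
  obtain ⟨x, hx, h⟩ := M.exists_C_eq i
  rw [h]; exact connectedComponentIn_subset _ _

theorem C_isPreconnected (i : Fin M.m) : IsPreconnected (M.C i) := by
  obtain ⟨x, hx, h⟩ := M.exists_C_eq i
  rw [h]; exact isPreconnected_connectedComponentIn

theorem exists_mem_C {x : Pt d} (hx : x ∈ levelSet p M.t) : ∃ i, x ∈ M.C i := by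
  have : connectedComponentIn (levelSet p M.t) x ∈ Set.range M.C := by
    rw [M.range_C]; exact ⟨x, hx, rfl⟩
  obtain ⟨i, hi⟩ := this
  exact ⟨i, hi ▸ mem_connectedComponentIn hx⟩

theorem C_subset_enlarged (i : Fin M.m) {s : ℝ} (hs : 0 ≤ s) :
    M.C i ⊆ enlarged p M.t (M.C i) s := fun _ hx =>
  mem_iUnion₂.2 ⟨_, hx, mem_connectedComponentIn
    (levelSet_anti (by linarith) (M.C_subset i hx))⟩

theorem C_measurable (i : Fin M.m) : MeasurableSet (M.C i) := (M.isCompact_C i).measurableSet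

theorem dist_ge_of_mem_C {i j : Fin M.m} (hij : i ≠ j) {x y : Pt d} (hx : x ∈ M.C i)
    (hy : y ∈ M.C j) : M.u i ≤ dist x y :=
  M.separated i j hij x (M.C_subset_enlarged i (by linarith [M.epsTilde_pos]) hx) y
    (M.C_subset_enlarged j (by linarith [M.epsTilde_pos]) hy)

theorem rhoMin_le (j : Fin M.m) : M.rhoMin ≤ M.ρ j := ciInf_le (finite_range _).bddBelow j

theorem rhoMin_pos (i : Fin M.m) : 0 < M.rhoMin := by
  have : Nonempty (Fin M.m) := ⟨i⟩
  obtain ⟨j, hj⟩ := exists_eq_ciInf_of_finite (f := M.ρ)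
  rw [rhoMin, ← hj]
  exact M.ρ_pos j

theorem le_pMax (hp : IsBoundedDensity p) (i : Fin M.m) {x : Pt d} (hx : x ∈ M.C i) :
    p x ≤ M.pMax i := by
  obtain ⟨B, hB⟩ := hp.bounded
  exact le_csSup ⟨B, by rintro _ ⟨y, -, rfl⟩; exact hB y⟩ (mem_image_of_mem p hx)

theorem t_le_pMax (hp : IsBoundedDensity p) (i : Fin M.m) : M.t ≤ M.pMax i := by
  obtain ⟨x, hx⟩ := M.C_nonempty i
  obtain ⟨y, hy, hxy⟩ := Metric.mem_closure_iff.1 (M.C_subset i hx) (M.u i) (M.u_pos i)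
  obtain ⟨j, hj⟩ := M.exists_mem_C (subset_closure hy)
  have hij : i = j := by
    by_contra h
    linarith [M.dist_ge_of_mem_C h hx hj]
  subst hij
  exact le_trans hy (M.le_pMax hp i hj)

theorem pMax_pos (hp : IsBoundedDensity p) (i : Fin M.m) : 0 < M.pMax i :=
  M.t_pos.trans_le (M.t_le_pMax hp i)

/-- A point of density at least `t` lies in some cluster, and within `u i` of `C i` this can only be
`C i`. Thus `pMax` controls the density outside the cluster as well, as needed for balls centred
near the boundary. -/
theorem le_pMax_of_dist_lt (hp : IsBoundedDensity p) (i : Fin M.m) {x y : Pt d} (hx : x ∈ M.C i)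
    (hy : dist x y < M.u i) : p y ≤ M.pMax i := by
  by_cases h : M.t ≤ p y
  · obtain ⟨j, hj⟩ := M.exists_mem_C (subset_closure h)
    have hij : i = j := by
      by_contra h
      linarith [M.dist_ge_of_mem_C h hx hj]
    subst hij
    exact M.le_pMax hp i hj
  · exact (not_le.1 h).le.trans (M.t_le_pMax hp i)

theorem mass_ball_le (hd : 0 < d) (hp : IsBoundedDensity p) (i : Fin M.m) {x : Pt d}
    (hx : x ∈ M.C i) {r : ℝ} (hr : 0 ≤ r) (hru : r ≤ M.u i) :
    (densityMeasure p).real (ball x r) ≤ M.pMax i * (r ^ d * unitBallVolume d) := by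
  rw [← volume_real_ball hd x hr]
  refine densityMeasure_real_le (M.pMax_pos hp i).le measurableSet_ball measure_ball_lt_top.ne
    fun y hy => M.le_pMax_of_dist_lt hp i hx ?_
  rw [mem_ball, dist_comm] at hy
  exact hy.trans_le hru

theorem rho_le_mass (hd : 0 < d) (hp : IsBoundedDensity p) (i : Fin M.m) :
    M.rhoMin ≤ M.pMax i * (M.u i ^ d * unitBallVolume d) := by
  obtain ⟨x, hx⟩ := M.C_nonempty i
  exact (M.rhoMin_le i).trans ((M.ρ_le i x (M.C_subset_enlarged i
    (by linarith [M.epsTilde_pos]) hx)).trans (M.mass_ball_le hd hp i hx (M.u_pos i).le le_rfl))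

theorem mass_C_le (hp : IsBoundedDensity p) (i : Fin M.m) :
    (densityMeasure p).real (M.C i) ≤ M.pMax i * (volume : Measure (Pt d)).real (M.C i) :=
  densityMeasure_real_le (M.pMax_pos hp i).le (M.C_measurable i) (M.isCompact_C i).measure_ne_top
    fun _ hx => M.le_pMax hp i hx

/-- Otherwise the lower level is at most `0`, the enlarged cluster is the whole space, and
infinitely many disjoint balls would each have mass at least `ρ i`. The result bounds `ε` by the
supremum of `p` in the noisy case. -/
theorem two_mul_epsTilde_lt (hd : 0 < d) (hp : IsBoundedDensity p) (i : Fin M.m) :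
    2 * M.epsTilde < M.t := by
  have := hp.isProbabilityMeasure
  by_contra hcon
  have huniv : ∀ x, x ∈ enlarged p M.t (M.C i) (2 * M.epsTilde) := fun x => by
    obtain ⟨y, hy⟩ := M.C_nonempty i
    have hl : levelSet p (M.t - 2 * M.epsTilde) = univ :=
      eq_univ_of_forall fun z => subset_closure (by
        have := hp.nonneg z
        simp only [mem_ofPred_eq]; linarith)
    refine mem_iUnion₂.2 ⟨y, hy, ?_⟩
    rw [hl, connectedComponentIn_univ, PreconnectedSpace.connectedComponent_eq_univ]
    trivial
  have : Nonempty (Fin d) := ⟨⟨0, hd⟩⟩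
  have hbound := M.ρ_le i
  have hρ := M.ρ_pos i
  -- translated balls are disjoint and all have mass at least `ρ i`
  obtain ⟨v, hv⟩ := exists_norm_eq (Pt d) (show 0 ≤ 2 * M.u i by linarith [M.u_pos i])
  have hdisj : Pairwise (Function.onFun Disjoint fun k : ℕ => ball ((k : ℝ) • v) (M.u i)) := by
    intro k l hkl
    refine ball_disjoint_ball ?_
    rw [dist_eq_norm, ← sub_smul, norm_smul, hv]
    have : (1 : ℝ) ≤ ‖(k : ℝ) - l‖ := by
      rw [Real.norm_eq_abs]
      have h1 : (1 : ℤ) ≤ |(k : ℤ) - l| := Int.one_le_abs (sub_ne_zero.2 (by exact_mod_cast hkl))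
      exact_mod_cast h1
    nlinarith [M.u_pos i]
  obtain ⟨N, hN⟩ := exists_nat_gt (1 / M.ρ i)
  have hsum : ∑ k ∈ Finset.range N, (densityMeasure p).real (ball ((k : ℝ) • v) (M.u i)) ≤ 1 := by
    rw [← measureReal_biUnion_finset (fun k _ l _ h => hdisj h) fun _ _ => measurableSet_ball]
    exact measureReal_le_one
  have h2 : (N : ℝ) * M.ρ i ≤ 1 := by
    refine le_trans ?_ hsum
    rw [← nsmul_eq_mul]
    have := Finset.card_nsmul_le_sum (Finset.range N)
      (fun k : ℕ => (densityMeasure p).real (ball ((k : ℝ) • v) (M.u i))) (M.ρ i)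
      fun k _ => hbound _ (huniv _)
    simpa using this
  rw [div_lt_iff₀ hρ] at hN
  linarith

end ClusterModel

/-! ### Nets and chains of sample points -/

section Chains

variable {d n : ℕ}

/-- The subgraph of the symmetric nearest-neighbour graph with the edges inside `A`. -/
def innerGraph (A : Set (Pt d)) (k : ℕ) (x : Fin n → Pt d) : SimpleGraph (Fin n) where
  Adj a b := (symGraph k x).Adj a b ∧ x a ∈ A ∧ x b ∈ A
  symm := ⟨fun _ _ h => ⟨h.1.symm, h.2.2, h.2.1⟩⟩
  loopless := ⟨fun _ h => (symGraph k x).loopless.irrefl _ h.1⟩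

/-- Each net point `c` gets a sample point `s c` near it. Sample points assigned to net points with
overlapping `w`-balls are adjacent or equal, and connectedness of `A` forces these balls to form a
single chain-connected family. -/
theorem reachable_of_net {x : Fin n → Pt d} {A : Set (Pt d)} (hA : IsPreconnected A)
    (F : Finset (Pt d)) {w r : ℝ} (hr : 0 < r) (hcov : ∀ y ∈ A, ∃ c ∈ F, dist y c ≤ w)
    (hs : ∀ c ∈ F, ∃ a, x a ∈ A ∧ dist (x a) c < r) (G : SimpleGraph (Fin n))
    (hG : ∀ a b, a ≠ b → x a ∈ A → x b ∈ A → dist (x a) (x b) ≤ 2 * r + 2 * w → G.Adj a b)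
    {a b : Fin n} (ha : x a ∈ A) (hb : x b ∈ A) : G.Reachable a b := by
  have hG' : ∀ a b, x a ∈ A → x b ∈ A → dist (x a) (x b) ≤ 2 * r + 2 * w → G.Reachable a b :=
    fun a b ha hb h => by
      by_cases hab : a = b
      · rw [hab]
      · exact (hG a b hab ha hb h).reachable
  have : Nonempty (Fin n) := ⟨a⟩
  choose! s hsA hsd using hs
  have hw : 0 ≤ w := by
    obtain ⟨c, -, hc⟩ := hcov _ ha
    exact dist_nonneg.trans hc
  have hsample : ∀ c ∈ F, ∀ a, x a ∈ A → dist (x a) c ≤ w → G.Reachable a (s c) :=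
    fun c hc a ha h => hG' _ _ ha (hsA c hc) (by
      have := dist_triangle_right (x a) (x (s c)) c
      have := hsd c hc
      linarith)
  have hnear : ∀ c ∈ F, ∀ c' ∈ F, dist c c' ≤ 2 * w → G.Reachable (s c) (s c') :=
    fun c hc c' hc' h => hG' _ _ (hsA c hc) (hsA c' hc') (by
      have h1 := dist_triangle4 (x (s c)) c c' (x (s c'))
      have := hsd c hc
      have h2 := hsd c' hc'
      rw [dist_comm] at h2
      linarith)
  obtain ⟨c, hc, hac⟩ := hcov _ ha
  obtain ⟨c', hc', hbc⟩ := hcov _ hb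
  suffices h : G.Reachable (s c) (s c') from
    (hsample c hc a ha hac).trans (h.trans (hsample c' hc' b hb hbc).symm)
  by_contra hcon
  classical
  -- The balls around reachable and around unreachable net points form two closed sets that cover
  -- `A`. Both meet `A`, so they share a point of `A`, and the two centres are within `2 * w`.
  let T := F.filter fun e => G.Reachable (s c) (s e)
  let T' := F.filter fun e => ¬ G.Reachable (s c) (s e)
  have hclosed : ∀ S : Finset (Pt d), IsClosed (⋃ e ∈ S, closedBall e w) := fun S =>
    S.finite_toSet.isClosed_biUnion fun e _ => isClosed_closedBall
  obtain ⟨y, hyA, hy1, hy2⟩ := isPreconnected_closed_iff.1 hA _ _ (hclosed T) (hclosed T')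
    (fun y hy => by
      obtain ⟨e, he, hye⟩ := hcov y hy
      by_cases h : G.Reachable (s c) (s e)
      · exact Or.inl (mem_iUnion₂.2 ⟨e, Finset.mem_filter.2 ⟨he, h⟩, hye⟩)
      · exact Or.inr (mem_iUnion₂.2 ⟨e, Finset.mem_filter.2 ⟨he, h⟩, hye⟩))
    ⟨x a, ha, mem_iUnion₂.2 ⟨c, Finset.mem_filter.2 ⟨hc, SimpleGraph.Reachable.refl _⟩, hac⟩⟩
    ⟨x b, hb, mem_iUnion₂.2 ⟨c', Finset.mem_filter.2 ⟨hc', hcon⟩, hbc⟩⟩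
  obtain ⟨e, he, hye⟩ := mem_iUnion₂.1 hy1
  obtain ⟨e', he', hye'⟩ := mem_iUnion₂.1 hy2
  obtain ⟨heF, her⟩ := Finset.mem_filter.1 he
  obtain ⟨heF', her'⟩ := Finset.mem_filter.1 he'
  refine her' (her.trans (hnear e heF e' heF' ?_))
  have := dist_triangle_left e e' y
  rw [mem_closedBall] at hye hye'
  linarith

theorem isKNN_of_ncard_lt {k : ℕ} {x : Fin n → Pt d} {a b : Fin n} {z : ℝ} (hab : a ≠ b)
    (h : {l | l ≠ b ∧ dist (x b) (x l) < z}.ncard < k) (hz : dist (x a) (x b) ≤ z) :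
    IsKNN k x a b := by
  refine ⟨hab, (ncard_le_ncard (fun l hl => ?_) (toFinite _)).trans_lt h⟩
  refine ⟨hl.1, ?_⟩
  rw [dist_comm]
  exact hl.2.trans_le hz

/-- A `w`-separated subset of maximal cardinality is a net. The balls of radius `w / 2` around its
points are disjoint, and each meets `A` in volume at least that of a ball of radius `w / 4`, which
bounds the cardinality. -/
theorem exists_net (hd : 0 < d) {A : Set (Pt d)} (hA : MeasurableSet A)
    (hfin : (volume : Measure (Pt d)) A ≠ ⊤) {w : ℝ} (hw : 0 < w) (hwr : w / 4 ≤ coveringRadius A) :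
    ∃ F : Finset (Pt d), ↑F ⊆ A ∧ (∀ y ∈ A, ∃ c ∈ F, dist y c ≤ w) ∧
      F.card * (ClusterModel.unitBallVolume d * (w / 4) ^ d) ≤ (volume : Measure (Pt d)).real A := by
  classical
  have hbound : ∀ F : Finset (Pt d), ↑F ⊆ A →
      (∀ c ∈ F, ∀ c' ∈ F, c ≠ c' → w ≤ dist c c') →
      F.card * (ClusterModel.unitBallVolume d * (w / 4) ^ d) ≤
        (volume : Measure (Pt d)).real A := by
    intro F hF hsep
    have h1 : ∑ c ∈ F, (volume : Measure (Pt d)).real (ball c (2 * (w / 4)) ∩ A) ≤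
        (volume : Measure (Pt d)).real A := by
      rw [← measureReal_biUnion_finset]
      · exact measureReal_mono (iUnion₂_subset fun c _ => inter_subset_right) hfin
      · intro c hc c' hc' hne
        refine Disjoint.mono inter_subset_left inter_subset_left (ball_disjoint_ball ?_)
        have := hsep c hc c' hc' hne
        linarith
      · exact fun c _ => measurableSet_ball.inter hA
    refine le_trans ?_ h1
    rw [← nsmul_eq_mul]
    exact Finset.card_nsmul_le_sum _ _ _ fun c hc =>
      le_volume_ball_inter hd (by positivity) hwr (hF hc)
  set S := {N : ℕ | ∃ F : Finset (Pt d), ↑F ⊆ A ∧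
    (∀ c ∈ F, ∀ c' ∈ F, c ≠ c' → w ≤ dist c c') ∧ F.card = N} with hS
  have hpos : 0 < ClusterModel.unitBallVolume d * (w / 4) ^ d :=
    mul_pos (unitBallVolume_pos d) (by positivity)
  have hbdd : BddAbove S := by
    refine ⟨⌊(volume : Measure (Pt d)).real A / (ClusterModel.unitBallVolume d * (w / 4) ^ d)⌋₊, ?_⟩
    rintro N ⟨F, hF, hsep, rfl⟩
    refine Nat.le_floor ?_
    rw [le_div_iff₀ hpos]
    exact hbound F hF hsep
  obtain ⟨F, hF, hsep, hcard⟩ := Nat.sSup_mem (s := S) ⟨0, ∅, by simp, by simp, by simp⟩ hbdd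
  refine ⟨F, hF, fun y hy => ?_, hbound F hF hsep⟩
  by_contra! hcon
  have hyF : y ∉ F := fun h => by
    have := hcon y h
    rw [dist_self] at this
    linarith
  have : F.card + 1 ∈ S := by
    refine ⟨insert y F, ?_, ?_, Finset.card_insert_of_notMem hyF⟩
    · rw [Finset.coe_insert]; exact insert_subset hy hF
    · intro c hc c' hc' hne
      rcases Finset.mem_insert.1 hc with h1 | h1 <;> rcases Finset.mem_insert.1 hc' with h2 | h2
      · exact absurd (h1.trans h2.symm) hne
      · rw [h1]; exact (hcon c' h2).le
      · rw [h2, dist_comm]; exact (hcon c h1).le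
      · exact hsep c h1 c' h2 hne
  have := le_csSup hbdd this
  omega

end Chains

/-! ### Connectivity within a cluster -/

theorem coveringRadius_nonneg {d : ℕ} (A : Set (Pt d)) : 0 ≤ coveringRadius A :=
  Real.sSup_nonneg fun _ h => h.1.le

theorem one_add_pow_le (d : ℕ) : (1 + 1 / (20 * (d : ℝ))) ^ d ≤ 11 / 10 := by
  rcases Nat.eq_zero_or_pos d with rfl | hd
  · norm_num
  have hd' : (0 : ℝ) < d := by exact_mod_cast hd
  have h1 : (1 + 1 / (20 * (d : ℝ))) ≤ Real.exp (1 / (20 * d)) := by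
    rw [add_comm]; exact Real.add_one_le_exp _
  calc _ ≤ Real.exp (1 / (20 * d)) ^ d := pow_le_pow_left₀ (by positivity) h1 d
    _ = Real.exp (1 / 20) := by rw [← Real.exp_nat_mul]; congr 1; field_simp
    _ ≤ 11 / 10 := by
      have := Real.exp_bound_div_one_sub_of_interval (x := 1 / 20) (by norm_num) (by norm_num)
      refine this.trans (by norm_num)

theorem exp_half_le : Real.exp (1 / 2) ≤ 33 / 20 := by
  have h : Real.exp (1 / 2) ^ 2 ≤ (33 / 20) ^ 2 := by
    rw [← Real.exp_nat_mul]
    have := Real.exp_one_lt_d9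
    norm_num at this ⊢
    linarith
  exact (pow_le_pow_iff_left₀ (Real.exp_pos _).le (by norm_num) two_ne_zero).1 h

namespace ClusterModel

variable {d : ℕ} {p : Pt d → ℝ} (M : ClusterModel p)

theorem n_mul_mass_le (hp : IsBoundedDensity p) (i : Fin M.m) {n k : ℕ}
    (hk : M.NeighbourBounds i n k) :
    2 * 8 ^ d * M.pMax i * (volume : Measure (Pt d)).real (M.C i) * n ≤
      Real.exp (k * (M.t / M.pMax i) / 4 ^ (d + 1)) := by
  refine (Real.le_exp_log _).trans (Real.exp_le_exp.2 ?_)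
  have hP := M.pMax_pos hp i
  have ht := M.t_pos
  refine le_trans (le_of_eq ?_) (div_le_div_of_nonneg_right
    (mul_le_mul_of_nonneg_right hk.1 (div_pos ht hP).le) (by positivity : (0:ℝ) ≤ 4 ^ (d + 1)))
  field_simp

theorem tau_le (hd : 0 < d) (hp : IsBoundedDensity p) (i : Fin M.m) :
    M.t / M.pMax i / 4 ^ (d + 1) ≤ 1 / 16 := by
  have hP := M.pMax_pos hp i
  have h4 : (4 : ℝ) ^ 2 ≤ 4 ^ (d + 1) := pow_le_pow_right₀ (by norm_num) (by omega)
  exact div_le_div₀ zero_le_one ((div_le_one hP).2 (M.t_le_pMax hp i)) (by norm_num)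
    (by linarith)

/-- The event that the sample points of a cluster are not connected to each other inside it has
small probability. -/
theorem measure_not_connected_le (hd : 0 < d) (hp : IsBoundedDensity p) (i : Fin M.m)
    (hge : ∀ᵐ x, x ∈ levelSet p M.t → M.t ≤ p x) {n k : ℕ} (hn : 2 ≤ n)
    (hk : M.NeighbourBounds i n k) (hkd : (20 * (d : ℝ)) ^ d ≤ k) :
    (sampleLaw p n).real {x | ¬ ∀ a b, x a ∈ M.C i → x b ∈ M.C i →
      (innerGraph (M.C i) k x).Reachable a b} ≤
      2 * Real.exp (-(k * (M.t / M.pMax i) / 4 ^ (d + 1))) := by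
  have := hp.isProbabilityMeasure
  have hd' : (0 : ℝ) < d := by exact_mod_cast hd
  have hn' : (2 : ℝ) ≤ n := by exact_mod_cast hn
  have hP := M.pMax_pos hp i
  have ht := M.t_pos
  have hη := unitBallVolume_pos d
  have hk0 : (0 : ℝ) < k := lt_of_lt_of_le (by positivity) hkd
  set η := unitBallVolume d with hηdef
  set P := M.pMax i with hPdef
  set V := (volume : Measure (Pt d)).real (M.C i) with hV
  set τ := k * (M.t / P) / 4 ^ (d + 1) with hτ
  have hc : 0 < ((n : ℝ) - 1) * (2 * 4 ^ d * η * P) := by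
    have : (0 : ℝ) < n - 1 := by linarith
    positivity
  -- With this `ν` the bound `P * η * (4 * ν) ^ d` on the mass of a ball of radius `4 * ν` is
  -- exactly `k / (2 * (n - 1))`, and the third upper bound on `k` says that `ν` is at most the
  -- covering radius.
  obtain ⟨ν, hν0, hνd⟩ : ∃ ν : ℝ, 0 < ν ∧ ν ^ d = k / (((n : ℝ) - 1) * (2 * 4 ^ d * η * P)) :=
    ⟨(k / (((n : ℝ) - 1) * (2 * 4 ^ d * η * P))) ^ ((d : ℝ)⁻¹), Real.rpow_pos_of_pos (by positivity) _,
      Real.rpow_inv_natCast_pow (by positivity) hd.ne'⟩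
  have hkν : (k : ℝ) = ((n : ℝ) - 1) * (2 * 4 ^ d * η * P) * ν ^ d := by
    rw [hνd, mul_div_cancel₀ _ hc.ne']
  have hνr : ν ≤ coveringRadius (M.C i) := by
    refine le_of_not_gt fun hlt => ?_
    have h1 : (k : ℝ) ≤ ((n : ℝ) - 1) * (2 * 4 ^ d * η * P *
      min (M.u i ^ d) (coveringRadius (M.C i) ^ d)) := hk.2.2
    have h2 : min (M.u i ^ d) (coveringRadius (M.C i) ^ d) < ν ^ d :=
      (min_le_right _ _).trans_lt (pow_lt_pow_left₀ hlt (coveringRadius_nonneg _) hd.ne')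
    have h3 := mul_lt_mul_of_pos_left h2 hc
    rw [← hkν] at h3
    linarith
  -- The mesh is so fine that enlarging the radius from `4 * ν` to `z` multiplies the volume by at
  -- most `11 / 10`.
  set w := ν / (10 * d) with hw
  have hw0 : 0 < w := by positivity
  set z := 2 * (2 * ν) + 2 * w with hz
  have hz0 : 0 < z := by positivity
  have hzd : z ^ d ≤ 11 / 10 * (4 ^ d * ν ^ d) := by
    have : z = 4 * ν * (1 + 1 / (20 * (d : ℝ))) := by
      rw [hz, hw]; field_simp; ring
    rw [this, mul_pow, mul_pow, mul_comm (11 / 10 : ℝ)]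
    exact mul_le_mul_of_nonneg_left (one_add_pow_le d) (by positivity)
  have hPz : ((n : ℝ) - 1) * (P * (z ^ d * η)) ≤ 11 / 20 * k := by
    have h1 : (0 : ℝ) ≤ ((n : ℝ) - 1) * (P * η) := by
      have : (0 : ℝ) < n - 1 := by linarith
      positivity
    have h2 := mul_le_mul_of_nonneg_left hzd h1
    rw [hkν]
    linarith
  have hzu : z ≤ M.u i := by
    refine le_of_not_gt fun hlt => ?_
    have h1 : M.u i ^ d ≤ z ^ d := pow_le_pow_left₀ (M.u_pos i).le hlt.le d
    have h2 := M.rho_le_mass hd hp i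
    have h3 : P * (M.u i ^ d * η) ≤ P * (z ^ d * η) := by gcongr
    have h4 := hk.2.1
    have h5 : 0 ≤ Real.log n := Real.log_natCast_nonneg n
    have h6 := mul_le_mul_of_nonneg_left (h2.trans h3) (show (0 : ℝ) ≤ n - 1 by linarith)
    linarith
  have hVn := M.n_mul_mass_le hp i hk
  have hτk : τ ≤ k / 16 := by
    have := mul_le_mul_of_nonneg_left (M.tau_le hd hp i) hk0.le
    rw [hτ]; rw [mul_div_assoc]; linarith
  obtain ⟨F, hFA, hFcov, hFcard⟩ := exists_net hd (M.C_measurable i)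
    (M.isCompact_C i).measure_ne_top hw0 (show w / 4 ≤ coveringRadius (M.C i) from
      le_trans (by
        have h1 : w ≤ ν := div_le_self hν0.le (by
          have : (1 : ℝ) ≤ d := by exact_mod_cast hd
          linarith)
        linarith) hνr)
  set B1 : Fin n → Set (Fin n → Pt d) := fun a =>
    {x | x a ∈ M.C i ∧ k ≤ {l | l ≠ a ∧ dist (x a) (x l) < z}.ncard} with hB1
  set B2 : Pt d → Set (Fin n → Pt d) := fun c => {x | ∀ l, x l ∉ ball c (2 * ν) ∩ M.C i} with hB2
  have hsub : {x : Fin n → Pt d | ¬ ∀ a b, x a ∈ M.C i → x b ∈ M.C i →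
      (innerGraph (M.C i) k x).Reachable a b} ⊆ (⋃ a, B1 a) ∪ ⋃ c ∈ F, B2 c := by
    intro x hx
    by_contra hcon
    refine hx fun a b ha hb => ?_
    simp only [mem_union, mem_iUnion, not_or, not_exists] at hcon
    obtain ⟨h1, h2⟩ := hcon
    refine reachable_of_net (M.C_isPreconnected i) F (w := w) (r := 2 * ν) (by positivity) hFcov
      (fun c hc => ?_) _ (fun a b hab ha hb h => ?_) ha hb
    · have := h2 c hc
      simp only [hB2, mem_ofPred_eq, not_forall, not_not] at this
      obtain ⟨l, hl⟩ := this
      exact ⟨l, hl.2, hl.1⟩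
    · refine ⟨Or.inl (isKNN_of_ncard_lt (z := z) hab ?_ h), ha, hb⟩
      by_contra hlt
      exact h1 b ⟨hb, not_lt.1 hlt⟩
  -- Chernoff with `s = 1 / 2`: the exponent is at most `13 / 20 * (11 / 20) * k - k / 2`, which is
  -- below `-k / 8`. The factor `P * V` bounds the mass of the cluster and must be kept, since only
  -- `n * P * V` is controlled by `exp τ`.
  have hm1 : ∀ a, (sampleLaw p n).real (B1 a) ≤ P * V * Real.exp (-(k / 8)) := fun a => by
    have hT : MeasurableSet {q : Pt d × Pt d | dist q.1 q.2 < z} :=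
      measurableSet_lt (measurable_fst.dist measurable_snd) measurable_const
    refine (pi_count_tail_at (densityMeasure p) n a {q | dist q.1 q.2 < z} hT (M.C i)
      (M.C_measurable i) (1 / 2) (13 / 20 * (P * (z ^ d * η))) (k / 2) (fun y hy => ?_) _
      fun x hx => ⟨hx.1, ?_⟩).trans ?_
    · have h1 := M.mass_ball_le hd hp i hy hz0.le hzu
      have h2 : {q | (y, q) ∈ {q : Pt d × Pt d | dist q.1 q.2 < z}} = ball y z := by
        ext q; rw [mem_ball, dist_comm]; rfl
      rw [h2]
      have h3 := exp_half_le
      exact mul_le_mul (by linarith) h1 measureReal_nonneg (by norm_num)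
    · have : (k : ℝ) ≤ {l | l ≠ a ∧ dist (x a) (x l) < z}.ncard := by exact_mod_cast hx.2
      simp only [mem_ofPred_eq] at this ⊢
      linarith
    · refine mul_le_mul (M.mass_C_le hp i) (Real.exp_le_exp.2 ?_) (Real.exp_pos _).le
        (mul_nonneg hP.le measureReal_nonneg)
      linarith
  have hm2 : ∀ c ∈ F, (sampleLaw p n).real (B2 c) ≤ Real.exp (-(2 * τ)) := fun c hc => by
    have h1 := le_volume_ball_inter hd hν0.le hνr (hFA hc)
    have h2 := le_densityMeasure_real (p := p) ht.le (measurableSet_ball.inter (M.C_measurable i))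
      (measure_ne_top _ (ball c (2 * ν) ∩ M.C i))
      (by filter_upwards [hge] with x hx hxB using hx (M.C_subset i hxB.2))
    refine (pi_avoid_le (densityMeasure p) n _ (measurableSet_ball.inter (M.C_measurable i))
      (M.t * (η * ν ^ d)) (le_trans (mul_le_mul_of_nonneg_left h1 ht.le) h2)).trans
      (Real.exp_le_exp.2 (neg_le_neg ?_))
    have h3 : 2 * τ = ((n : ℝ) - 1) * (M.t * (η * ν ^ d)) := by
      rw [hτ, hkν, pow_succ]; field_simp; ring
    rw [h3]
    have : 0 ≤ M.t * (η * ν ^ d) := by positivity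
    nlinarith
  -- The fineness of the net costs a factor of order `(20 * d) ^ d` in the cardinality, which the
  -- assumption `(20 * d) ^ d ≤ k` absorbs. What remains is the quantity inside the logarithm in the
  -- lower bound on `k`.
  have hcard : (F.card : ℝ) ≤ Real.exp τ := by
    have h1 : (F.card : ℝ) * (η * (w / 4) ^ d) * k ≤ V * (((n : ℝ) - 1) * (2 * 4 ^ d * η * P) * ν ^ d) := by
      rw [← hkν]
      exact mul_le_mul_of_nonneg_right hFcard hk0.le
    have h2 : (w / 4) ^ d * (20 * (d : ℝ)) ^ d = ν ^ d / 2 ^ d := by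
      rw [← mul_pow, ← div_pow, hw]; congr 1; field_simp; norm_num
    have h3 : (F.card : ℝ) * (η * (w / 4) ^ d) * (20 * (d : ℝ)) ^ d ≤
        (F.card : ℝ) * (η * (w / 4) ^ d) * k := mul_le_mul_of_nonneg_left hkd
        (mul_nonneg (Nat.cast_nonneg _) (mul_nonneg hη.le (pow_nonneg (by linarith) d)))
    have h4 : (F.card : ℝ) * (η * (w / 4) ^ d) * (20 * (d : ℝ)) ^ d =
        (F.card : ℝ) * (η * ν ^ d) / 2 ^ d := by
      rw [mul_assoc, mul_assoc, h2]; ring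
    have h5 : (F.card : ℝ) * (η * ν ^ d) ≤
        (2 * 8 ^ d * P * V * ((n : ℝ) - 1)) * (η * ν ^ d) := by
      rw [h4] at h3
      have := (div_le_iff₀ (by positivity)).1 (h3.trans h1)
      refine this.trans (le_of_eq ?_)
      have : (8 : ℝ) ^ d = 4 ^ d * 2 ^ d := by rw [← mul_pow]; norm_num
      rw [this]; ring
    have h6 := le_of_mul_le_mul_right h5 (by positivity)
    have h7 : 0 ≤ 2 * 8 ^ d * P * V := by
      have : 0 ≤ V := measureReal_nonneg
      positivity
    refine h6.trans (le_trans ?_ hVn)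
    exact mul_le_mul_of_nonneg_left (by linarith) h7
  calc _ ≤ (sampleLaw p n).real ((⋃ a, B1 a) ∪ ⋃ c ∈ F, B2 c) :=
        have : IsProbabilityMeasure (sampleLaw p n) := by unfold sampleLaw; infer_instance
        measureReal_mono hsub
    _ ≤ (sampleLaw p n).real (⋃ a, B1 a) + (sampleLaw p n).real (⋃ c ∈ F, B2 c) :=
        measureReal_union_le _ _
    _ ≤ Real.exp (-τ) + Real.exp (-τ) := by
        refine add_le_add ?_ ?_
        · refine (measureReal_iUnion_fintype_le _).trans ((Finset.sum_le_sum fun a _ => hm1 a).trans ?_)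
          rw [Finset.sum_const, Finset.card_univ, Fintype.card_fin, nsmul_eq_mul]
          have h8 : (n : ℝ) * (P * V) ≤ Real.exp τ := by
            refine le_trans ?_ hVn
            have h7 : 0 ≤ P * V * n := by
              have : 0 ≤ V := measureReal_nonneg
              positivity
            have h9 : (1 : ℝ) ≤ 2 * 8 ^ d := by
              have : (1 : ℝ) ≤ 8 ^ d := one_le_pow₀ (by norm_num)
              linarith
            have := mul_le_mul_of_nonneg_right h9 h7
            linarith
          calc _ = (n : ℝ) * (P * V) * Real.exp (-(k / 8)) := by ring
            _ ≤ Real.exp τ * Real.exp (-(k / 8)) := by gcongr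
            _ = Real.exp (τ - k / 8) := by rw [← Real.exp_add]; ring_nf
            _ ≤ _ := Real.exp_le_exp.2 (by linarith)
        · refine (measureReal_biUnion_finset_le _ _).trans ((Finset.sum_le_sum hm2).trans ?_)
          rw [Finset.sum_const, nsmul_eq_mul]
          calc _ ≤ Real.exp τ * Real.exp (-(2 * τ)) := by gcongr
            _ = _ := by rw [← Real.exp_add]; ring_nf
    _ = _ := by ring

end ClusterModel

/-! ### Separation between clusters -/

theorem reachable_invariant {V : Type*} {G : SimpleGraph V} {Q : V → Prop}
    (hQ : ∀ a b, G.Adj a b → Q a → Q b) {a b : V} (h : G.Reachable a b) (ha : Q a) : Q b := by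
  obtain ⟨w⟩ := h
  induction w with
  | nil => exact ha
  | cons hadj _ ih => exact ih (hQ _ _ hadj ha)

namespace ClusterModel

variable {d : ℕ} {p : Pt d → ℝ} (M : ClusterModel p)

/-- A point of an enlarged cluster has fewer than `k` other sample points near it. -/
def SparseAt {n : ℕ} (k : ℕ) (x : Fin n → Pt d) : Prop :=
  ∃ j a, x a ∈ enlarged p M.t (M.C j) (2 * M.epsTilde) ∧
    {l | l ≠ a ∧ dist (x a) (x l) < M.u j}.ncard < k

/-- Chernoff with `s = -1` and `exp (-1) - 1 ≤ -1 / 2` gives `exp (-(2 * E))` for each point and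
cluster; having at most `k - 1` neighbours is what produces `k - 1` in the exponent. The second
bound on `k` implies `log n ≤ E`, which pays for the union over the points. -/
theorem measure_sparseAt_le (hp : IsBoundedDensity p) (i : Fin M.m) {n k : ℕ} (hn : 2 ≤ n)
    (hk : M.NeighbourBounds i n k) :
    (sampleLaw p n).real {x | M.SparseAt k x} ≤
      M.m * Real.exp (-(((n : ℝ) - 1) / 2 * (M.rhoMin / 2 - ((k : ℝ) - 1) / ((n : ℝ) - 1)))) := by
  have := hp.isProbabilityMeasure
  have : IsProbabilityMeasure (sampleLaw p n) := by unfold sampleLaw; infer_instance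
  have hn' : (2 : ℝ) ≤ n := by exact_mod_cast hn
  set μ := densityMeasure p with hμ
  set E := ((n : ℝ) - 1) / 2 * (M.rhoMin / 2 - ((k : ℝ) - 1) / ((n : ℝ) - 1)) with hE
  have hEeq : 2 * E = ((n : ℝ) - 1) * M.rhoMin / 2 - (k - 1) := by
    have : (n : ℝ) - 1 ≠ 0 := by linarith
    rw [hE]; field_simp
  set B : Fin M.m → Fin n → Set (Fin n → Pt d) := fun j a =>
    {x | x a ∈ enlarged p M.t (M.C j) (2 * M.epsTilde) ∧
      {l | l ≠ a ∧ dist (x a) (x l) < M.u j}.ncard < k} with hB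
  have hsub : {x : Fin n → Pt d | M.SparseAt k x} ⊆ ⋃ j, ⋃ a, B j a := by
    rintro x ⟨j, a, h⟩
    exact mem_iUnion₂.2 ⟨j, a, h⟩
  have hexp : Real.exp (-1) ≤ 1 / 2 := by
    rw [Real.exp_neg, one_div]
    refine inv_anti₀ (by norm_num) ?_
    have := Real.add_one_le_exp 1
    linarith
  have hm : ∀ j a, (sampleLaw p n).real (B j a) ≤ Real.exp (-(2 * E)) := fun j a => by
    have hT : MeasurableSet {q : Pt d × Pt d | dist q.1 q.2 < M.u j} :=
      measurableSet_lt (measurable_fst.dist measurable_snd) measurable_const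
    have hball : ∀ y, {z | (y, z) ∈ {q : Pt d × Pt d | dist q.1 q.2 < M.u j}} = ball y (M.u j) :=
      fun y => by ext q; rw [mem_ball, dist_comm]; rfl
    -- The points whose ball has mass at least `rhoMin` form a measurable set containing the
    -- enlarged cluster, so the latter need not be shown measurable.
    have hD : MeasurableSet {y | M.rhoMin ≤
        μ.real {z | (y, z) ∈ {q : Pt d × Pt d | dist q.1 q.2 < M.u j}}} :=
      measurableSet_le measurable_const (measurable_measure_prodMk_left hT).ennreal_toReal
    refine (pi_count_tail_at μ n a {q | dist q.1 q.2 < M.u j} hT _ hD (-1)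
      (-(1 / 2) * M.rhoMin) (-((k : ℝ) - 1)) (fun y hy => ?_) _ fun x hx => ⟨?_, ?_⟩).trans ?_
    · have h1 : M.rhoMin ≤ μ.real {z | (y, z) ∈ {q : Pt d × Pt d | dist q.1 q.2 < M.u j}} := hy
      have h2 := M.rhoMin_pos i
      nlinarith
    · change M.rhoMin ≤ μ.real _
      rw [hball]
      exact (M.rhoMin_le j).trans (M.ρ_le j _ hx.1)
    · have h1 : {l | l ≠ a ∧ dist (x a) (x l) < M.u j}.ncard + 1 ≤ k := hx.2
      have h2 : ({l | l ≠ a ∧ dist (x a) (x l) < M.u j}.ncard : ℝ) + 1 ≤ k := by exact_mod_cast h1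
      simp only [mem_ofPred_eq] at h2 ⊢
      linarith
    · refine le_trans (mul_le_of_le_one_left (Real.exp_pos _).le measureReal_le_one)
        (Real.exp_le_exp.2 ?_)
      rw [hEeq]
      linarith
  have hlog : Real.log n ≤ E := by
    have := hk.2.1
    linarith
  have hnE : (n : ℝ) ≤ Real.exp E := by
    rw [← Real.exp_log (show (0 : ℝ) < n by linarith)]
    exact Real.exp_le_exp.2 hlog
  calc _ ≤ (sampleLaw p n).real (⋃ j, ⋃ a, B j a) := measureReal_mono hsub
    _ ≤ ∑ j : Fin M.m, ∑ a : Fin n, (sampleLaw p n).real (B j a) :=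
        (measureReal_iUnion_fintype_le _).trans
          (Finset.sum_le_sum fun j _ => measureReal_iUnion_fintype_le _)
    _ ≤ ∑ _j : Fin M.m, ∑ _a : Fin n, Real.exp (-(2 * E)) :=
        Finset.sum_le_sum fun j _ => Finset.sum_le_sum fun a _ => hm j a
    _ = M.m * (n * Real.exp (-(2 * E))) := by simp
    _ ≤ M.m * (Real.exp E * Real.exp (-(2 * E))) := by gcongr
    _ = _ := by rw [← Real.exp_add]; ring_nf

/-- If `x a` were a nearest neighbour of `x b` from another enlarged cluster, all sample points
within `u j'` of `x b` would be closer than `x a`, so there would be fewer than `k` of them. -/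
theorem eq_of_adj_of_not_sparseAt {n k : ℕ} {x : Fin n → Pt d} (h : ¬ M.SparseAt k x)
    {a b : Fin n} (hab : (symGraph k x).Adj a b) {j j' : Fin M.m}
    (ha : x a ∈ enlarged p M.t (M.C j) (2 * M.epsTilde))
    (hb : x b ∈ enlarged p M.t (M.C j') (2 * M.epsTilde)) : j = j' := by
  have key : ∀ a b : Fin n, ∀ j j' : Fin M.m, IsKNN k x a b →
      x a ∈ enlarged p M.t (M.C j) (2 * M.epsTilde) →
      x b ∈ enlarged p M.t (M.C j') (2 * M.epsTilde) → j = j' := by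
    intro a b j j' hk ha hb
    by_contra hne
    refine h ⟨j', b, hb, (ncard_le_ncard (fun l hl => ?_) (toFinite _)).trans_lt hk.2⟩
    refine ⟨hl.1, ?_⟩
    have h1 := M.separated j' j (Ne.symm hne) _ hb _ ha
    have h2 := hl.2
    rw [dist_comm] at h1 h2
    exact h2.trans_le h1
  rcases hab with hab | hab
  · exact key a b j j' hab ha hb
  · exact (key b a j' j hab hb ha).symm

theorem enlarged_disjoint {x : Pt d} {j j' : Fin M.m}
    (h : x ∈ enlarged p M.t (M.C j) (2 * M.epsTilde))
    (h' : x ∈ enlarged p M.t (M.C j') (2 * M.epsTilde)) : j = j' := by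
  by_contra hne
  have := M.separated j j' hne x h x h'
  rw [dist_self] at this
  linarith [M.u_pos j]

/-- The number of neighbours is zero or large if the sample is large. -/
theorem exists_forall_eq_zero_or_le (hd : 0 < d) (hp : IsBoundedDensity p) (i : Fin M.m) (R : ℝ)
    (hR : 0 ≤ R) :
    ∃ N : ℕ, ∀ n : ℕ, N ≤ n → ∀ k : ℕ, M.NeighbourBounds i n k → k = 0 ∨ R ≤ k := by
  have hP := M.pMax_pos hp i
  rcases (measureReal_nonneg (μ := (volume : Measure (Pt d))) (s := M.C i)).eq_or_lt with hV | hV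
  -- For a cluster of volume zero `Real.log 0 = 0`, so the lower bound on `k` is void. The covering
  -- radius is then `0`, and the third bound forces `k = 0`.
  · refine ⟨1, fun n hn k hk => Or.inl ?_⟩
    obtain ⟨x, hx⟩ := M.C_nonempty i
    have h1 := le_volume_ball_inter hd (coveringRadius_nonneg _) le_rfl hx
    have h2 := measureReal_mono (μ := (volume : Measure (Pt d)))
      (inter_subset_right (s := ball x (2 * coveringRadius (M.C i))) (t := M.C i))
      (M.isCompact_C i).measure_ne_top
    have h3 : coveringRadius (M.C i) ^ d ≤ 0 := by
      by_contra h
      have := mul_pos (unitBallVolume_pos d) (not_le.1 h)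
      linarith
    have h4 := hk.2.2
    have h5 : (0 : ℝ) ≤ (n : ℝ) - 1 := by
      have : (1 : ℝ) ≤ n := by exact_mod_cast hn
      linarith
    have h6 : ((n : ℝ) - 1) * (2 * 4 ^ d * unitBallVolume d * M.pMax i *
        min (M.u i ^ d) (coveringRadius (M.C i) ^ d)) ≤ 0 := by
      have := unitBallVolume_pos d
      exact mul_nonpos_of_nonneg_of_nonpos h5 (mul_nonpos_of_nonneg_of_nonpos (by positivity)
        ((min_le_right _ _).trans h3))
    have h7 : (k : ℝ) ≤ 0 := h4.trans h6
    exact Nat.le_zero.1 (by exact_mod_cast h7)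
  · set c := 2 * 8 ^ d * M.pMax i * (volume : Measure (Pt d)).real (M.C i) with hc
    have hc0 : 0 < c := by positivity
    obtain ⟨N, hN⟩ := exists_nat_ge (Real.exp R / c)
    refine ⟨N, fun n hn k hk => Or.inr ?_⟩
    have h1 : Real.exp R ≤ c * n := by
      have : (N : ℝ) ≤ n := by exact_mod_cast hn
      rw [div_le_iff₀ hc0] at hN
      nlinarith
    have h2 : R ≤ Real.log (c * n) :=
      (Real.le_log_iff_exp_le ((Real.exp_pos R).trans_le h1)).2 h1
    have h3 : (1 : ℝ) ≤ 4 ^ (d + 1) * (M.pMax i / M.t) := by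
      have h4 : (1 : ℝ) ≤ 4 ^ (d + 1) := one_le_pow₀ (by norm_num)
      have h5 : 1 ≤ M.pMax i / M.t := (one_le_div M.t_pos).2 (M.t_le_pMax hp i)
      nlinarith
    have h6 := hk.1
    have h7 := mul_le_mul_of_nonneg_right h3 (hR.trans h2)
    linarith

/-! ### The exponents -/

theorem exponent_kOpt (hp : IsBoundedDensity p) (i : Fin M.m) {n : ℕ} (hn : 2 ≤ n) :
    ((n : ℝ) - 1) / 2 * (M.rhoMin / 2 - (M.kOpt i n - 1) / ((n : ℝ) - 1)) =
        ((n : ℝ) - 1) * M.OmegaNoiseFree i ∧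
      (M.kOpt i n - 1) / 4 ^ (d + 1) * (M.t / M.pMax i) = ((n : ℝ) - 1) * M.OmegaNoiseFree i := by
  have hP := M.pMax_pos hp i
  have ht := M.t_pos
  have hn' : (0 : ℝ) < (n : ℝ) - 1 := by
    have : (2 : ℝ) ≤ n := by exact_mod_cast hn
    linarith
  have h4 : (0 : ℝ) < 4 ^ d := by positivity
  unfold kOpt Gam OmegaNoiseFree
  rw [pow_succ]
  have h1 : 2 + 1 / 4 ^ d * (M.t / M.pMax i) = (2 * 4 ^ d * M.pMax i + M.t) / (4 ^ d * M.pMax i) := by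
    field_simp
  have h2 : 2 * ((4 : ℝ) ^ d * 4) * (M.pMax i / M.t) + 4 =
      4 * (2 * 4 ^ d * M.pMax i + M.t) / M.t := by
    field_simp
  rw [h1, h2]
  have h3 : 2 * 4 ^ d * M.pMax i + M.t ≠ 0 := by positivity
  constructor <;> (field_simp; ring)

theorem exponent_eq_kOpt (hp : IsBoundedDensity p) (i : Fin M.m) {n : ℕ} (hn : 2 ≤ n) :
    M.exponent i n (M.kOpt i n) = ((n : ℝ) - 1) * M.OmegaNoiseFree i := by
  obtain ⟨h1, h2⟩ := M.exponent_kOpt hp i hn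
  rw [exponent, h1, h2, min_self]

theorem exponent_lt_kOpt (hp : IsBoundedDensity p) (i : Fin M.m) {n : ℕ} (hn : 2 ≤ n) {k : ℝ}
    (hk : k ≠ M.kOpt i n) : M.exponent i n k < M.exponent i n (M.kOpt i n) := by
  obtain ⟨h1, h2⟩ := M.exponent_kOpt hp i hn
  rw [M.exponent_eq_kOpt hp i hn]
  have hn' : (0 : ℝ) < (n : ℝ) - 1 := by
    have : (2 : ℝ) ≤ n := by exact_mod_cast hn
    linarith
  rcases lt_or_gt_of_ne hk with h | h
  · refine (min_le_right _ _).trans_lt ?_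
    rw [← h2]
    have := div_pos M.t_pos (M.pMax_pos hp i)
    gcongr
  · refine (min_le_left _ _).trans_lt ?_
    rw [← h1]
    gcongr

/-- The exponent `e` is available for the error bounds: it is at most the exponent of the bound
for between-cluster connectivity and that of the bound for within-cluster connectivity. -/
def Attainable (i : Fin M.m) (n k : ℕ) (e : ℝ) : Prop :=
  e ≤ ((n : ℝ) - 1) / 2 * (M.rhoMin / 2 - ((k : ℝ) - 1) / ((n : ℝ) - 1)) ∧
    e ≤ k * (M.t / M.pMax i) / 4 ^ (d + 1)

theorem attainable_exponent (hp : IsBoundedDensity p) (i : Fin M.m) (n k : ℕ) :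
    M.Attainable i n k (M.exponent i n k) := by
  refine ⟨min_le_left _ _, (min_le_right _ _).trans ?_⟩
  have := div_pos M.t_pos (M.pMax_pos hp i)
  rw [div_mul_eq_mul_div]
  gcongr
  linarith

/-- Rounding down only improves the between-cluster exponent. The within-cluster bound holds with
`k` in place of `k - 1`, and this spare `1` covers the loss from rounding. -/
theorem attainable_floor (hp : IsBoundedDensity p) (i : Fin M.m) {n k : ℕ} (hn : 2 ≤ n)
    (hk : k = ⌊M.kOpt i n⌋₊) :
    M.Attainable i n k (((n : ℝ) - 1) * M.OmegaNoiseFree i) := by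
  obtain ⟨h1, h2⟩ := M.exponent_kOpt hp i hn
  have hn' : (0 : ℝ) < (n : ℝ) - 1 := by
    have : (2 : ℝ) ≤ n := by exact_mod_cast hn
    linarith
  have hτ := div_pos M.t_pos (M.pMax_pos hp i)
  have hk0 : 0 ≤ M.kOpt i n := by
    have := M.rhoMin_pos i
    unfold kOpt Gam
    positivity
  have hk1 : (k : ℝ) ≤ M.kOpt i n := by rw [hk]; exact Nat.floor_le hk0
  have hk2 : M.kOpt i n - 1 ≤ k := by
    rw [hk]; linarith [Nat.lt_floor_add_one (M.kOpt i n)]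
  constructor
  · rw [← h1]
    gcongr
  · rw [← h2, div_mul_eq_mul_div]
    gcongr

/-! ### The noise-free case -/

theorem identified_of_not_sparseAt (hi : Fin M.m) {n k : ℕ} {x : Fin n → Pt d}
    (hx : ∀ a, x a ∈ levelSet p M.t) (hs : ¬ M.SparseAt k x)
    (hc : ∀ a b, x a ∈ M.C hi → x b ∈ M.C hi → (innerGraph (M.C hi) k x).Reachable a b) :
    Identified M.C hi x (symGraph k x) := by
  have hsub : ∀ j, M.C j ⊆ enlarged p M.t (M.C j) (2 * M.epsTilde) := fun j =>
    M.C_subset_enlarged j (by linarith [M.epsTilde_pos])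
  have hle : innerGraph (M.C hi) k x ≤ symGraph k x := fun _ _ h => h.1
  refine ⟨fun a b ha hb => (hc a b ha hb).mono hle, fun j hj a b ha hb hr => ?_⟩
  have hb' : x b ∈ M.C hi := reachable_invariant (Q := fun a => x a ∈ M.C hi)
    (fun a b hab ha => by
      obtain ⟨j', hj'⟩ := M.exists_mem_C (hx b)
      rwa [M.eq_of_adj_of_not_sparseAt hs hab (hsub _ ha) (hsub _ hj')]) hr ha
  exact hj (M.enlarged_disjoint (hsub _ hb) (hsub _ hb'))

theorem one_sub_le_measure_identified (hd : 0 < d) (hp : IsBoundedDensity p) (hM : M.NoiseFree)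
    (i : Fin M.m) : ∃ N : ℕ, 2 ≤ N ∧ ∀ n : ℕ, N ≤ n → ∀ k : ℕ, M.NeighbourBounds i n k →
      ∀ e, M.Attainable i n k e →
        1 - ((M.m : ℝ) + 2) * Real.exp (-e) ≤
          (sampleLaw p n).real {x | Identified M.C i x (symGraph k x)} := by
  have := hp.isProbabilityMeasure
  obtain ⟨N, hN⟩ := M.exists_forall_eq_zero_or_le hd hp i ((20 * (d : ℝ)) ^ d) (by positivity)
  refine ⟨max N 2, le_max_right _ _, fun n hn k hk e he => ?_⟩
  have hn2 : 2 ≤ n := (le_max_right _ _).trans hn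
  have : IsProbabilityMeasure (sampleLaw p n) := by unfold sampleLaw; infer_instance
  -- For `k = 0` an attainable exponent is at most `0`, and the claimed lower bound is not positive.
  rcases hN n ((le_max_left _ _).trans hn) k hk with rfl | hkR
  · have h1 : e ≤ 0 := by simpa using he.2
    have h2 : 1 ≤ Real.exp (-e) := Real.one_le_exp (by linarith)
    have h3 : (0 : ℝ) ≤ M.m := Nat.cast_nonneg _
    have h4 : 0 ≤ (sampleLaw p n).real {x | Identified M.C i x (symGraph 0 x)} :=
      measureReal_nonneg
    nlinarith
  refine one_sub_le_measureReal (B := {x | M.SparseAt k x} ∪ {x | ¬ ∀ a b, x a ∈ M.C i →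
    x b ∈ M.C i → (innerGraph (M.C i) k x).Reachable a b}) ?_ ?_
  · have h0 : ∀ᵐ y ∂(densityMeasure p), y ∈ levelSet p M.t := by
      have hcl : MeasurableSet (levelSet p M.t) := isClosed_closure.measurableSet
      have := densityMeasure_apply_le (p := p) (c := 0) hcl.compl fun y hy => (hM.1 y hy).le
      rw [ENNReal.ofReal_zero, zero_mul] at this
      exact measure_eq_zero_iff_ae_notMem.1 (le_antisymm this bot_le) |>.mono fun y hy => by
        simpa using hy
    have h1 : ∀ᵐ x ∂(sampleLaw p n), ∀ a, x a ∈ levelSet p M.t :=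
      ae_all_iff.2 fun a => (measurePreserving_eval (fun _ : Fin n => densityMeasure p)
        a).quasiMeasurePreserving.ae h0
    filter_upwards [h1] with x hx hxB
    simp only [mem_union, mem_ofPred_eq, not_or, not_not] at hxB
    exact M.identified_of_not_sparseAt i hx hxB.1 hxB.2
  · refine (measureReal_union_le _ _).trans ?_
    have h1 := M.measure_sparseAt_le hp i hn2 hk
    have h2 := M.measure_not_connected_le hd hp i hM.2 hn2 hk hkR
    have h3 := mul_le_mul_of_nonneg_left (Real.exp_le_exp.2 (neg_le_neg he.1))
      (Nat.cast_nonneg (α := ℝ) M.m)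
    have h4 := Real.exp_le_exp.2 (neg_le_neg he.2)
    linarith

end ClusterModel

/-! ### Second differences of a function with bounded second derivative -/

section SecondDifference

variable {E : Type*} [NormedAddCommGroup E] [NormedSpace ℝ E]

theorem norm_fderiv_sub_le {f : E → ℝ} (hf : ContDiff ℝ 2 f) {B : ℝ}
    (hB : ∀ x, ‖iteratedFDeriv ℝ 2 f x‖ ≤ B) (x y : E) :
    ‖fderiv ℝ f x - fderiv ℝ f y‖ ≤ B * ‖x - y‖ := by
  have hdiff : Differentiable ℝ (fderiv ℝ f) :=
    (hf.fderiv_right (m := 1) (by norm_num)).differentiable (by norm_num)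
  refine Convex.norm_image_sub_le_of_norm_fderiv_le (fun z _ => hdiff z) (fun z _ => ?_)
    convex_univ (mem_univ y) (mem_univ x)
  rw [← norm_iteratedFDeriv_one, norm_iteratedFDeriv_fderiv]
  exact hB z

theorem abs_second_difference_le {f : E → ℝ} (hf : ContDiff ℝ 2 f) {B : ℝ}
    (hB : ∀ x, ‖iteratedFDeriv ℝ 2 f x‖ ≤ B) (y v : E) :
    |f (y + v) + f (y - v) - 2 * f y| ≤ 2 * B * ‖v‖ ^ 2 := by
  have hB0 : 0 ≤ B := (norm_nonneg _).trans (hB y)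
  have hdiff : Differentiable ℝ f := hf.differentiable (by norm_num)
  have key : ∀ v : E, ‖f (y + v) - f y - fderiv ℝ f y v‖ ≤ B * ‖v‖ ^ 2 := fun v => by
    have := Convex.norm_image_sub_le_of_norm_fderiv_le' (𝕜 := ℝ) (f := f) (C := B * ‖v‖)
      (s := closedBall y ‖v‖) (φ := fderiv ℝ f y) (x := y) (y := y + v)
      (fun z _ => hdiff z) (fun z hz => (norm_fderiv_sub_le hf hB z y).trans (by
        rw [mem_closedBall, dist_eq_norm] at hz
        gcongr)) (convex_closedBall _ _) (mem_closedBall_self (norm_nonneg _)) (by simp)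
    simpa [pow_two, mul_assoc] using this
  have h1 := abs_le.1 (key v)
  have h2 := key (-v)
  rw [norm_neg, ← sub_eq_add_neg, map_neg, Real.norm_eq_abs] at h2
  have h2 := abs_le.1 h2
  rw [abs_le]
  constructor <;> linarith [h1.1, h1.2, h2.1, h2.2]

end SecondDifference

/-! ### Bias and concentration of the kernel density estimate -/

section KernelEstimate

variable {d : ℕ} {p K : Pt d → ℝ}

theorem integral_densityMeasure (hp : IsBoundedDensity p) (f : Pt d → ℝ) :
    ∫ z, f z ∂(densityMeasure p) = ∫ z, p z * f z := by
  rw [densityMeasure, integral_withDensity_eq_integral_toReal_smul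
    hp.measurable.ennreal_ofReal (Filter.Eventually.of_forall fun _ => ENNReal.ofReal_lt_top)]
  simp only [ENNReal.toReal_ofReal (hp.nonneg _), smul_eq_mul]

theorem integral_comp_rescale (g : Pt d → ℝ) (y : Pt d) {h : ℝ} (hh : 0 < h) :
    ∫ z, g (h⁻¹ • (y - z)) = h ^ d * ∫ w, g w := by
  rw [integral_sub_left_eq_self (fun v => g (h⁻¹ • v)), Measure.integral_comp_smul]
  rw [finrank_euclideanSpace, Fintype.card_fin, smul_eq_mul, inv_pow, inv_inv,
    abs_of_pos (by positivity)]

theorem integral_kernel_density (hp : IsBoundedDensity p) (L : Pt d → ℝ) (y : Pt d) {h : ℝ}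
    (hh : 0 < h) :
    ∫ z, L (h⁻¹ • (y - z)) ∂(densityMeasure p) = h ^ d * ∫ w, p (y - h • w) * L w := by
  rw [integral_densityMeasure hp, ← integral_comp_rescale (fun w => p (y - h • w) * L w) y hh]
  refine integral_congr_ae (Filter.Eventually.of_forall fun z => ?_)
  simp only
  rw [smul_inv_smul₀ hh.ne', sub_sub_cancel]

theorem integrable_density_mul (hp : IsBoundedDensity p) {L : Pt d → ℝ} (hL : Integrable L)
    (y : Pt d) (h : ℝ) : Integrable fun w => p (y - h • w) * L w := by
  obtain ⟨B, hB⟩ := hp.bounded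
  refine hL.bdd_mul (c := B) (hp.measurable.comp (by fun_prop)).aestronglyMeasurable
    (Filter.Eventually.of_forall fun w => ?_)
  rw [Real.norm_of_nonneg (hp.nonneg _)]
  exact hB _

/-- The bias of the kernel density estimate with bandwidth `h` is of the order `h ^ 2`. -/
theorem abs_bias_le (hp : IsBoundedDensity p) (hK : IsKernel K) (hf : ContDiff ℝ 2 p) {B : ℝ}
    (hB : ∀ x, ‖iteratedFDeriv ℝ 2 p x‖ ≤ B) (y : Pt d) (h : ℝ) :
    |(∫ w, p (y - h • w) * K w) - p y| ≤ B * h ^ 2 * ∫ w, |‖w‖ ^ 2 * K w| := by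
  have hI := integrable_density_mul hp hK.integrable y h
  have hI' : Integrable fun w => p (y + h • w) * K w := by
    have := integrable_density_mul hp hK.integrable y (-h)
    simpa [sub_neg_eq_add] using this
  -- Symmetry of the kernel turns the bias into an integral of second differences, so the
  -- first-order term drops out.
  have hsymm : ∫ w, p (y + h • w) * K w = ∫ w, p (y - h • w) * K w := by
    rw [← integral_neg_eq_self]
    simp [hK.symmetric, sub_eq_add_neg]
  have h1 : 2 * ((∫ w, p (y - h • w) * K w) - p y) =
      ∫ w, (p (y + h • w) + p (y - h • w) - 2 * p y) * K w := by
    have : ∀ w, (p (y + h • w) + p (y - h • w) - 2 * p y) * K w =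
        p (y + h • w) * K w + p (y - h • w) * K w - 2 * p y * K w := fun w => by ring
    simp only [this]
    have hI2 : Integrable fun w => p (y + h • w) * K w + p (y - h • w) * K w := hI'.add hI
    rw [integral_sub hI2 (hK.integrable.const_mul _), integral_add hI' hI, hsymm,
      integral_const_mul, hK.integral_eq_one]
    ring
  have h2 : |∫ w, (p (y + h • w) + p (y - h • w) - 2 * p y) * K w| ≤
      ∫ w, 2 * B * h ^ 2 * |‖w‖ ^ 2 * K w| := by
    rw [← Real.norm_eq_abs]
    refine norm_integral_le_of_norm_le (hK.second_moment.abs.const_mul _)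
      (Filter.Eventually.of_forall fun w => ?_)
    rw [norm_mul, Real.norm_eq_abs, Real.norm_eq_abs, abs_mul, abs_of_nonneg (sq_nonneg ‖w‖)]
    have := abs_second_difference_le hf hB y (h • w)
    rw [norm_smul, mul_pow, Real.norm_eq_abs, sq_abs] at this
    calc _ ≤ 2 * B * (h ^ 2 * ‖w‖ ^ 2) * |K w| := by gcongr
      _ = _ := by ring
  rw [← h1, integral_const_mul, abs_mul, abs_two] at h2
  linarith

/-- Since `K ^ 2 ≤ b * |K|`, a summand has second moment of order `h ^ d`. This, rather than the
trivial bound `b ^ 2`, puts `h ^ d` and not `h ^ (2 * d)` into the exponent. -/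
theorem second_moment_rescale_le (hp : IsBoundedDensity p) (hK : IsKernel K) {b Bp : ℝ}
    (hb : ∀ x, |K x| ≤ b) (hBp : ∀ x, p x ≤ Bp) (y : Pt d) {h : ℝ} (hh : 0 < h) :
    ∫ z, K (h⁻¹ • (y - z)) ^ 2 ∂(densityMeasure p) ≤ h ^ d * (Bp * b * ∫ w, |K w|) := by
  rw [integral_kernel_density hp (fun w => K w ^ 2) y hh, ← integral_const_mul (Bp * b)]
  refine mul_le_mul_of_nonneg_left ?_ (by positivity)
  have hb0 : 0 ≤ b := (abs_nonneg _).trans (hb 0)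
  refine integral_mono_of_nonneg (Filter.Eventually.of_forall fun w =>
    mul_nonneg (hp.nonneg _) (sq_nonneg _)) (hK.integrable.abs.const_mul _)
    (Filter.Eventually.of_forall fun w => ?_)
  simp only
  have h1 : K w ^ 2 ≤ b * |K w| := by
    rw [← sq_abs, sq]; exact mul_le_mul_of_nonneg_right (hb w) (abs_nonneg _)
  have h2 := mul_le_mul (hBp (y - h • w)) h1 (sq_nonneg _) ((hp.nonneg y).trans (hBp y))
  linarith

/-- The exponential moments of one summand of the kernel density estimate. -/
theorem lintegral_exp_kernel_le (hp : IsBoundedDensity p) (hK : IsKernel K) {b Bp : ℝ}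
    (hb : ∀ x, |K x| ≤ b) (hBp : ∀ x, p x ≤ Bp) (y : Pt d) {h s : ℝ} (hh : 0 < h)
    (hs : |s| * b ≤ 1) :
    ∫⁻ z, ENNReal.ofReal (Real.exp (s * K (h⁻¹ • (y - z)))) ∂(densityMeasure p) ≤
      ENNReal.ofReal (Real.exp (s * (h ^ d * ∫ w, p (y - h • w) * K w) +
        s ^ 2 * (h ^ d * (Bp * b * ∫ w, |K w|)))) := by
  have := hp.isProbabilityMeasure
  have hmeas : Measurable fun z => K (h⁻¹ • (y - z)) := hK.measurable.comp (by fun_prop)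
  have hint : Integrable (fun z => K (h⁻¹ • (y - z))) (densityMeasure p) :=
    Integrable.of_bound hmeas.aestronglyMeasurable b (Filter.Eventually.of_forall fun z => hb _)
  have hint2 : Integrable (fun z => K (h⁻¹ • (y - z)) ^ 2) (densityMeasure p) :=
    Integrable.of_bound (hmeas.pow_const 2).aestronglyMeasurable (b ^ 2)
      (Filter.Eventually.of_forall fun z => by
        rw [norm_pow, Real.norm_eq_abs]
        exact pow_le_pow_left₀ (abs_nonneg _) (hb _) 2)
  have hpt : ∀ z, Real.exp (s * K (h⁻¹ • (y - z))) ≤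
      1 + s * K (h⁻¹ • (y - z)) + s ^ 2 * K (h⁻¹ • (y - z)) ^ 2 := fun z => by
    have h1 : |s * K (h⁻¹ • (y - z))| ≤ 1 := by
      rw [abs_mul]
      exact (mul_le_mul_of_nonneg_left (hb _) (abs_nonneg s)).trans hs
    have := (abs_le.1 (Real.abs_exp_sub_one_sub_id_le h1)).2
    rw [mul_pow] at this
    linarith
  calc _ ≤ ∫⁻ z, ENNReal.ofReal (1 + s * K (h⁻¹ • (y - z)) + s ^ 2 * K (h⁻¹ • (y - z)) ^ 2)
          ∂(densityMeasure p) := lintegral_mono fun z => ENNReal.ofReal_le_ofReal (hpt z)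
    _ = ENNReal.ofReal (∫ z, (1 + s * K (h⁻¹ • (y - z)) + s ^ 2 * K (h⁻¹ • (y - z)) ^ 2)
          ∂(densityMeasure p)) :=
        (ofReal_integral_eq_lintegral_ofReal
          (((integrable_const _).add (hint.const_mul s)).add (hint2.const_mul _))
          (Filter.Eventually.of_forall fun z => (Real.exp_pos _).le.trans (hpt z))).symm
    _ ≤ _ := by
        refine ENNReal.ofReal_le_ofReal ?_
        have hint1 : Integrable (fun z => 1 + s * K (h⁻¹ • (y - z))) (densityMeasure p) :=
          (integrable_const _).add (hint.const_mul s)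
        rw [integral_add hint1 (hint2.const_mul _),
          integral_add (integrable_const _) (hint.const_mul s), integral_const_mul,
          integral_const_mul, integral_kernel_density hp K y hh]
        have h1 := mul_le_mul_of_nonneg_left (second_moment_rescale_le hp hK hb hBp y hh)
          (sq_nonneg s)
        have h2 := Real.add_one_le_exp (s * (h ^ d * ∫ w, p (y - h • w) * K w) +
          s ^ 2 * (h ^ d * (Bp * b * ∫ w, |K w|)))
        simp only [integral_const, probReal_univ, smul_eq_mul]
        linarith

/-- Deviations of the kernel density estimate at a sample point, in the direction of the sign
of `s`. -/
theorem measure_kde_deviation_le (hp : IsBoundedDensity p) (hK : IsKernel K) {b Bp V : ℝ}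
    (hb : ∀ x, |K x| ≤ b) (hBp : ∀ x, p x ≤ Bp) (hV : Bp * b * ∫ w, |K w| ≤ V) {h s ε : ℝ}
    (hh : 0 < h) (hs : |s| * b ≤ 1) (hε : 0 ≤ ε)
    (hbias : ∀ y, |(∫ w, p (y - h • w) * K w) - p y| ≤ ε / 4) (n : ℕ) (a : Fin n) :
    (sampleLaw p n).real {x | |s| * ε ≤ s * (kde K h x (x a) - p (x a))} ≤
      Real.exp (|s| * (h ^ d * Bp + b) - n * h ^ d * (|s| * (3 / 4 * ε) - s ^ 2 * V)) := by
  have := hp.isProbabilityMeasure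
  have hn1 : (1 : ℝ) ≤ n := by
    have := a.pos
    exact_mod_cast this
  have hhd : 0 < h ^ d := by positivity
  refine real_le_of_le_ofReal (Real.exp_pos _).le ?_
  have hm : Measurable (Function.uncurry fun y z : Pt d =>
      ENNReal.ofReal (Real.exp (s * K (h⁻¹ • (y - z))))) := by
    have h1 : Measurable fun q : Pt d × Pt d => K (h⁻¹ • (q.1 - q.2)) :=
      hK.measurable.comp (by fun_prop)
    exact (Real.measurable_exp.comp (h1.const_mul s)).ennreal_ofReal
  -- This factor collects what depends on the point with index `a` alone, including its own summand
  -- `K 0`. The own summand and the passage from `n` to `n - 1` cost the factor `exp (|s| * (h ^ d *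
  -- Bp + b))`.
  have hg : Measurable fun y => ENNReal.ofReal (Real.exp
      (s * (K 0 - n * h ^ d * p y) - |s| * (n * h ^ d * ε))) :=
    (Real.measurable_exp.comp ((((hp.measurable.const_mul _).const_sub _).const_mul s).sub_const
      _)).ennreal_ofReal
  refine (pi_le_lintegral_mul_pow (densityMeasure p) n a _ hm _ hg _ fun x hx => ?_).trans ?_
  · rw [← ENNReal.ofReal_prod_of_nonneg fun l _ => (Real.exp_pos _).le, ← Real.exp_sum,
      ← Finset.mul_sum, ← ENNReal.ofReal_mul (Real.exp_pos _).le, ← Real.exp_add,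
      ENNReal.one_le_ofReal, Real.one_le_exp_iff]
    have h1 : ∑ l, K (h⁻¹ • (x a - x l)) =
        K 0 + ∑ l ∈ Finset.univ.erase a, K (h⁻¹ • (x a - x l)) := by
      rw [← Finset.add_sum_erase _ _ (Finset.mem_univ a), sub_self, smul_zero]
    have h2 : |s| * ε ≤ s * (kde K h x (x a) - p (x a)) := hx
    have h3 : (n : ℝ) * h ^ d * kde K h x (x a) =
        K 0 + ∑ l ∈ Finset.univ.erase a, K (h⁻¹ • (x a - x l)) := by
      rw [← h1, kde]
      have : (n : ℝ) ≠ 0 := by linarith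
      field_simp
    have h4 := mul_le_mul_of_nonneg_left h2 (show (0 : ℝ) ≤ n * h ^ d by positivity)
    have h5 : (n : ℝ) * h ^ d * (s * (kde K h x (x a) - p (x a))) =
        s * (n * h ^ d * kde K h x (x a)) - s * (n * h ^ d * p (x a)) := by ring
    rw [h5, h3] at h4
    linarith
  · have hn : ((n - 1 : ℕ) : ℝ) = (n : ℝ) - 1 := by
      rw [Nat.cast_sub (by have := a.pos; omega)]; simp
    refine (lintegral_mono (g := fun _ => ENNReal.ofReal (Real.exp (|s| * (h ^ d * Bp + b) -
      n * h ^ d * (|s| * (3 / 4 * ε) - s ^ 2 * V)))) fun y => ?_).trans_eq (by simp)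
    refine (mul_le_mul_right (pow_le_pow_left' (lintegral_exp_kernel_le hp hK hb hBp y hh hs)
      (n - 1)) _).trans ?_
    rw [← ENNReal.ofReal_pow (Real.exp_pos _).le, ← ENNReal.ofReal_mul (Real.exp_pos _).le,
      ← Real.exp_nat_mul, ← Real.exp_add, hn]
    refine ENNReal.ofReal_le_ofReal (Real.exp_le_exp.2 ?_)
    set J := ∫ w, p (y - h • w) * K w with hJ
    have h1 : s * (J - p y) ≤ |s| * (ε / 4) := by
      calc _ ≤ |s * (J - p y)| := le_abs_self _
        _ = |s| * |J - p y| := abs_mul _ _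
        _ ≤ _ := mul_le_mul_of_nonneg_left (hbias y) (abs_nonneg s)
    have h2 : s * K 0 ≤ |s| * b := by
      calc _ ≤ |s * K 0| := le_abs_self _
        _ = |s| * |K 0| := abs_mul _ _
        _ ≤ _ := mul_le_mul_of_nonneg_left (hb 0) (abs_nonneg s)
    have h3 : -s * p y ≤ |s| * Bp := by
      have h31 : -s * p y ≤ |s| * p y := mul_le_mul_of_nonneg_right (neg_le_abs s) (hp.nonneg y)
      have h32 := mul_le_mul_of_nonneg_left (hBp y) (abs_nonneg s)
      linarith
    have h4 := mul_le_mul_of_nonneg_left hV (sq_nonneg s)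
    have h0 : 0 ≤ Bp * b * ∫ w, |K w| := by
      have hb0 : 0 ≤ b := (abs_nonneg _).trans (hb 0)
      have hB0 : 0 ≤ Bp := (hp.nonneg y).trans (hBp y)
      have : 0 ≤ ∫ w, |K w| := integral_nonneg fun w => abs_nonneg _
      positivity
    have h5 : (n - 1 : ℝ) * h ^ d * (s * (J - p y)) ≤ (n - 1 : ℝ) * h ^ d * (|s| * (ε / 4)) :=
      mul_le_mul_of_nonneg_left h1 (mul_nonneg (by linarith) hhd.le)
    have h5' : (n - 1 : ℝ) * h ^ d * (|s| * (ε / 4)) ≤ n * h ^ d * (|s| * (ε / 4)) := by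
      gcongr
      linarith
    have h6 : (n - 1 : ℝ) * (s ^ 2 * (h ^ d * (Bp * b * ∫ w, |K w|))) ≤ n * h ^ d * (s ^ 2 * V) := by
      calc _ = (n - 1 : ℝ) * h ^ d * (s ^ 2 * (Bp * b * ∫ w, |K w|)) := by ring
        _ ≤ n * h ^ d * (s ^ 2 * V) := by
          refine mul_le_mul ?_ h4 (by positivity) (by positivity)
          exact mul_le_mul_of_nonneg_right (by linarith) hhd.le
    have h7 := mul_le_mul_of_nonneg_left h3 hhd.le
    nlinarith

theorem exists_forall_mul_le_exp (c : ℝ) {κ : ℝ} (hκ : 0 < κ) :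
    ∃ N : ℕ, ∀ n : ℕ, N ≤ n → (n : ℝ) * c ≤ Real.exp (κ * n) := by
  obtain ⟨N, hN⟩ := exists_nat_ge (2 * c / κ ^ 2)
  refine ⟨N, fun n hn => ?_⟩
  have hn' : (N : ℝ) ≤ n := by exact_mod_cast hn
  have h1 := Real.quadratic_le_exp_of_nonneg (show 0 ≤ κ * n by positivity)
  have h2 : 2 * c ≤ κ ^ 2 * n := by
    rw [div_le_iff₀ (by positivity)] at hN
    nlinarith [sq_nonneg κ]
  have h3 : 0 ≤ κ * n := by positivity
  have h4 := mul_le_mul_of_nonneg_right h2 (Nat.cast_nonneg (α := ℝ) n)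
  nlinarith

/-- With high probability the kernel density estimate is close to the density at all the sample
points. -/
theorem kde_concentration (hp : IsBoundedDensity p) (hC : IsC3Bounded p) (hK : IsKernel K)
    {Bp : ℝ} (hBp : ∀ x, p x ≤ Bp) :
    ∃ C₁ C₂ : ℝ, 0 < C₁ ∧ 0 < C₂ ∧ ∀ ε h : ℝ, 0 < ε → ε ≤ Bp → 0 < h → h ^ 2 ≤ C₁ * ε →
      ∃ N : ℕ, ∀ n : ℕ, N ≤ n →
        (sampleLaw p n).real {x | ∃ a, ε ≤ |kde K h x (x a) - p (x a)|} ≤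
          Real.exp (-(C₂ * n * h ^ d * ε ^ 2)) := by
  have := hp.isProbabilityMeasure
  obtain ⟨B₂, hB₂⟩ := hC.2 2 (by norm_num)
  obtain ⟨b, hb⟩ := hK.bounded
  have hb0 : 0 ≤ b := (abs_nonneg _).trans (hb 0)
  have hBp0 : 0 ≤ Bp := (hp.nonneg 0).trans (hBp 0)
  have hB₂0 : 0 ≤ B₂ := (norm_nonneg _).trans (hB₂ 0)
  set m₂ := ∫ w, |‖w‖ ^ 2 * K w| with hm₂
  have hm₂0 : 0 ≤ m₂ := integral_nonneg fun w => abs_nonneg _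
  have hK1 : 0 ≤ ∫ w, |K w| := integral_nonneg fun w => abs_nonneg _
  -- The first term bounds the second moment, the second ensures `s * b ≤ 1` when `ε ≤ Bp`, and the
  -- `1` keeps `V` positive.
  set V := Bp * b * (∫ w, |K w|) + Bp * b + 1 with hV
  have hV0 : 0 < V := by positivity
  refine ⟨1 / (4 * (B₂ * m₂ + 1)), 1 / (16 * V), by positivity, by positivity,
    fun ε h hε hεB hh hhε => ?_⟩
  have hbias : ∀ y, |(∫ w, p (y - h • w) * K w) - p y| ≤ ε / 4 := fun y => by
    refine (abs_bias_le hp hK (hC.1.of_le (by norm_num)) hB₂ y h).trans ?_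
    rw [one_div_mul_eq_div, le_div_iff₀ (by positivity)] at hhε
    nlinarith [sq_nonneg h]
  -- With this `s`, `s * (3 / 4 * ε) - s ^ 2 * V = ε ^ 2 / (8 * V)`, so the exponent is `2 * κ * n`
  -- up to a constant; one half of it absorbs the union over `n` points and two signs for large `n`.
  set s := ε / (4 * V) with hs
  have hs0 : 0 < s := by positivity
  have hsb : s * b ≤ 1 := by
    rw [hs, div_mul_eq_mul_div, div_le_one (by positivity)]
    have h1 : ε * b ≤ Bp * b := mul_le_mul_of_nonneg_right hεB hb0
    have h2 : 0 ≤ Bp * b * ∫ w, |K w| := by positivity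
    have h3 : 0 ≤ Bp * b := by positivity
    linarith
  set κ := h ^ d * ε ^ 2 / (16 * V) with hκ
  obtain ⟨N, hN⟩ := exists_forall_mul_le_exp (2 * Real.exp (s * (h ^ d * Bp + b)))
    (show 0 < κ by positivity)
  refine ⟨N, fun n hn => ?_⟩
  have : IsProbabilityMeasure (sampleLaw p n) := by unfold sampleLaw; infer_instance
  have hdev : ∀ (σ : ℝ) (_ : |σ| = s) (a : Fin n),
      (sampleLaw p n).real {x | |σ| * ε ≤ σ * (kde K h x (x a) - p (x a))} ≤
        Real.exp (s * (h ^ d * Bp + b) - 2 * (κ * n)) := fun σ hσ a => by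
    refine (measure_kde_deviation_le hp hK hb hBp (V := V) (by
      have : 0 ≤ Bp * b := by positivity
      linarith) hh (by rw [hσ]; exact hsb) hε.le hbias n a).trans (Real.exp_le_exp.2 ?_)
    rw [← sq_abs, hσ]
    refine le_of_eq ?_
    rw [hκ, hs]
    field_simp
    ring
  have hsub : {x : Fin n → Pt d | ∃ a, ε ≤ |kde K h x (x a) - p (x a)|} ⊆
      ⋃ a, ({x | |s| * ε ≤ s * (kde K h x (x a) - p (x a))} ∪
        {x | |-s| * ε ≤ -s * (kde K h x (x a) - p (x a))}) := by
    rintro x ⟨a, ha⟩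
    refine mem_iUnion.2 ⟨a, ?_⟩
    simp only [mem_union, mem_ofPred_eq, abs_neg, abs_of_pos hs0]
    rcases le_abs.1 ha with h1 | h1
    · exact Or.inl (mul_le_mul_of_nonneg_left h1 hs0.le)
    · refine Or.inr ?_
      have := mul_le_mul_of_nonneg_left h1 hs0.le
      linarith
  calc _ ≤ _ := measureReal_mono hsub
    _ ≤ ∑ a : Fin n, (Real.exp (s * (h ^ d * Bp + b) - 2 * (κ * n)) +
          Real.exp (s * (h ^ d * Bp + b) - 2 * (κ * n))) :=
        (measureReal_iUnion_fintype_le _).trans (Finset.sum_le_sum fun a _ =>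
          (measureReal_union_le _ _).trans (add_le_add (hdev s (abs_of_pos hs0) a)
            (hdev (-s) (by rw [abs_neg, abs_of_pos hs0]) a)))
    _ = n * (2 * Real.exp (s * (h ^ d * Bp + b))) * Real.exp (-(2 * (κ * n))) := by
        rw [Finset.sum_const, Finset.card_univ, Fintype.card_fin, nsmul_eq_mul, sub_eq_add_neg,
          Real.exp_add]
        ring
    _ ≤ Real.exp (κ * n) * Real.exp (-(2 * (κ * n))) := by
        gcongr
        exact hN n hn
    _ = _ := by
        rw [← Real.exp_add, hκ]
        congr 1
        field_simp
        ring

end KernelEstimate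

/-! ### Pruned graphs and the noisy case -/

theorem induce_reachable_of_reachable {V : Type*} {G G' : SimpleGraph V} {U : Set V}
    (h : ∀ a b, G'.Adj a b → G.Adj a b ∧ a ∈ U ∧ b ∈ U) {a b : V} (hab : G'.Reachable a b)
    (ha : a ∈ U) (hb : b ∈ U) : (G.induce U).Reachable ⟨a, ha⟩ ⟨b, hb⟩ := by
  have := reachable_invariant
    (Q := fun c => ∃ hc : c ∈ U, (G.induce U).Reachable ⟨a, ha⟩ ⟨c, hc⟩)
    (fun c c' hcc ⟨hc, hr⟩ => by
      obtain ⟨h1, -, h3⟩ := h c c' hcc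
      have hadj : (G.induce U).Adj ⟨c, hc⟩ ⟨c', h3⟩ := h1
      exact ⟨h3, hr.trans hadj.reachable⟩) hab ⟨ha, SimpleGraph.Reachable.refl _⟩
  exact this.2

theorem largeVertices_subset {n : ℕ} (G : SimpleGraph (Fin n)) (V : Set (Fin n)) (δ : ℝ) :
    largeVertices G V δ ⊆ V := fun _ h => h.1

/-- A component of `G.induce V` that meets the large vertices is a component of the graph on the
large vertices. -/
theorem reachable_large {n : ℕ} {G : SimpleGraph (Fin n)} {V : Set (Fin n)} {δ : ℝ}
    {a b : V} (hab : (G.induce V).Reachable a b) (ha : a.1 ∈ largeVertices G V δ) :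
    ∃ hb : b.1 ∈ largeVertices G V δ,
      (G.induce (largeVertices G V δ)).Reachable ⟨a.1, ha⟩ ⟨b.1, hb⟩ := by
  have hlarge : ∀ c : V, (G.induce V).Reachable a c → c.1 ∈ largeVertices G V δ := fun c hc => by
    obtain ⟨haV, hcard⟩ := ha
    refine ⟨c.2, hcard.trans (le_of_eq ?_)⟩
    congr 2
    ext e
    exact ⟨fun h => hc.symm.trans h, fun h => hc.trans h⟩
  have := reachable_invariant
    (Q := fun c : V => (G.induce V).Reachable a c ∧ ∃ hc : c.1 ∈ largeVertices G V δ,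
      (G.induce (largeVertices G V δ)).Reachable ⟨a.1, ha⟩ ⟨c.1, hc⟩)
    (fun c c' hcc ⟨hr, hc, hr'⟩ => by
      have hr2 := hr.trans hcc.reachable
      have hadj : (G.induce (largeVertices G V δ)).Adj ⟨c.1, hc⟩ ⟨c'.1, hlarge c' hr2⟩ := hcc
      exact ⟨hr2, hlarge c' hr2, hr'.trans hadj.reachable⟩) hab
    ⟨SimpleGraph.Reachable.refl _, ha, SimpleGraph.Reachable.refl _⟩
  exact this.2

namespace ClusterModel

variable {d : ℕ} {p : Pt d → ℝ} (M : ClusterModel p)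

theorem roughlyIdentified_of_events (hlev : ∀ x ∈ levelSet p M.t, M.t ≤ p x) (i : Fin M.m)
    {n k : ℕ} {x : Fin n → Pt d} {K : Pt d → ℝ} {h δ ε : ℝ} (hε : 0 < ε) (hεt : ε ≤ M.epsTilde)
    (hcover : levelSet p (M.t - 2 * ε) ⊆ ⋃ j, enlarged p M.t (M.C j) (2 * ε))
    (hkde : ∀ a, |kde K h x (x a) - p (x a)| < ε) (hs : ¬ M.SparseAt k x)
    (hc : ∀ a b, x a ∈ M.C i → x b ∈ M.C i → (innerGraph (M.C i) k x).Reachable a b)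
    (hmany : δ * n ≤ ({a | x a ∈ M.C i}.ncard : ℝ))
    (hfew : ({a | x a ∈ ⋃ j, (enlarged p M.t (M.C j) (2 * ε) \ M.C j)}.ncard : ℝ) < δ * n) :
    RoughlyIdentified M.C i x (tildeVertices K h k (M.t - ε) δ x)
      (tildeSymGraph K h k (M.t - ε) δ x) := by
  set V := keptVertices K h (M.t - ε) x with hVdef
  set G := symGraph k x with hG
  have hC : ∀ j a, x a ∈ M.C j → a ∈ V := fun j a ha => by
    have h1 := hlev _ (M.C_subset j ha)
    have h2 := (abs_lt.1 (hkde a)).1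
    change M.t - ε ≤ kde K h x (x a)
    linarith
  have hVenl : ∀ a ∈ V, ∃ j, x a ∈ enlarged p M.t (M.C j) (2 * ε) := fun a ha => by
    have h1 : M.t - ε ≤ kde K h x (x a) := ha
    have h2 := (abs_lt.1 (hkde a)).2
    have h3 : x a ∈ levelSet p (M.t - 2 * ε) := subset_closure (by
      simp only [mem_ofPred_eq]; linarith)
    exact mem_iUnion.1 (hcover h3)
  have hmono : ∀ j, enlarged p M.t (M.C j) (2 * ε) ⊆ enlarged p M.t (M.C j) (2 * M.epsTilde) :=
    fun j => enlarged_mono _ (by linarith)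
  have hCenl : ∀ j, M.C j ⊆ enlarged p M.t (M.C j) (2 * M.epsTilde) := fun j =>
    M.C_subset_enlarged j (by linarith)
  have hconn : ∀ {U : Set (Fin n)}, (∀ a, x a ∈ M.C i → a ∈ U) → ∀ a b (ha : a ∈ U) (hb : b ∈ U),
      x a ∈ M.C i → x b ∈ M.C i → (G.induce U).Reachable ⟨a, ha⟩ ⟨b, hb⟩ :=
    fun hU a b ha hb hxa hxb => induce_reachable_of_reachable
      (fun a' b' (hadj : (innerGraph (M.C i) k x).Adj a' b') => ⟨hadj.1, hU _ hadj.2.1, hU _ hadj.2.2⟩) (hc a b hxa hxb) ha hb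
  have hW : ∀ a, x a ∈ M.C i → a ∈ tildeVertices K h k (M.t - ε) δ x := fun a ha => by
    refine ⟨hC i a ha, hmany.trans ?_⟩
    have : {a | x a ∈ M.C i} = Subtype.val '' {b : V | x b ∈ M.C i} := by
      ext b
      exact ⟨fun hb => ⟨⟨b, hC i b hb⟩, hb, rfl⟩, fun ⟨c, hcx, hcb⟩ => hcb ▸ hcx⟩
    rw [this, ncard_image_of_injective _ Subtype.val_injective]
    refine Nat.cast_le.2 (ncard_le_ncard (fun b hb => ?_) (toFinite _))
    exact hconn (hC i) a b.1 (hC i a ha) b.2 ha hb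
  refine ⟨hW, fun a b ha hb => hconn hW a b a.2 b.2 ha hb, fun c => ?_⟩
  induction c using SimpleGraph.ConnectedComponent.ind with
  | h a =>
  obtain ⟨haV, hcard⟩ := a.2
  -- A kept component without cluster points would lie entirely in the strips, which contain fewer
  -- than `δ * n` sample points.
  obtain ⟨b, hab, j, hbj⟩ : ∃ b : V, (G.induce V).Reachable ⟨a.1, haV⟩ b ∧ ∃ j, x b ∈ M.C j := by
    by_contra! hcon
    refine absurd (hcard.trans ?_) (not_le.2 hfew)
    rw [← ncard_image_of_injective _ Subtype.val_injective]
    refine Nat.cast_le.2 (ncard_le_ncard ?_ (toFinite _))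
    rintro _ ⟨b, hb, rfl⟩
    obtain ⟨j, hj⟩ := hVenl b b.2
    exact mem_iUnion.2 ⟨j, hj, hcon b hb j⟩
  obtain ⟨hbW, hreach⟩ := reachable_large hab a.2
  refine ⟨j, ⟨⟨b.1, hbW⟩, SimpleGraph.ConnectedComponent.eq.2 hreach.symm, hbj⟩, ?_⟩
  rintro j' ⟨a', ha', haj'⟩
  have hr : (tildeSymGraph K h k (M.t - ε) δ x).Reachable ⟨b.1, hbW⟩ a' :=
    hreach.symm.trans (SimpleGraph.ConnectedComponent.eq.1 ha').symm
  have := reachable_invariant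
    (Q := fun w : tildeVertices K h k (M.t - ε) δ x =>
      x w ∈ enlarged p M.t (M.C j) (2 * M.epsTilde))
    (fun w w' hww hw => by
      obtain ⟨j'', hj''⟩ := hVenl w' (largeVertices_subset _ _ _ w'.2)
      have hadj : (symGraph k x).Adj w w' := hww
      rw [M.eq_of_adj_of_not_sparseAt hs hadj hw (hmono _ hj'')]
      exact hmono _ hj'') hr (hCenl j hbj)
  exact M.enlarged_disjoint (hCenl j' haj') this

theorem measure_few_in_cluster_le (hp : IsBoundedDensity p) (i : Fin M.m) {δ : ℝ}
    (hδ : 0 < δ) (hδC : 2 * δ < (densityMeasure p).real (M.C i)) (n : ℕ) :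
    (sampleLaw p n).real {x | ({a | x a ∈ M.C i}.ncard : ℝ) < δ * n} ≤
      Real.exp (-(n * δ / 8)) := by
  have := hp.isProbabilityMeasure
  have he : Real.exp (-1) ≤ 7 / 16 := by
    have := Real.exp_neg_one_lt_d9
    linarith
  -- As `exp (-1) - 1 ≤ -9 / 16` and the cluster has mass above `2 * δ`, the exponent is `-(9 / 8) *
  -- δ * n + δ * n`.
  refine (pi_count_tail (densityMeasure p) n (M.C i) (M.C_measurable i) (-1) (-(9 / 16) * (2 * δ))
    (-(δ * n)) (by nlinarith) _ fun x hx => ?_).trans (Real.exp_le_exp.2 ?_)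
  · have : ({a | x a ∈ M.C i}.ncard : ℝ) < δ * n := hx
    linarith
  · have : 0 ≤ n * δ := by positivity
    linarith

theorem measure_many_in_strips_le (hp : IsBoundedDensity p) {S : Set (Pt d)} {δ : ℝ}
    (hδ : 0 < δ) (hS : (densityMeasure p).real S ≤ δ / 2) (n : ℕ) :
    (sampleLaw p n).real {x | δ * n ≤ ({a | x a ∈ S}.ncard : ℝ)} ≤ Real.exp (-(n * δ / 8)) := by
  have := hp.isProbabilityMeasure
  have he := exp_half_le
  have hT : (densityMeasure p).real (toMeasurable (densityMeasure p) S) ≤ δ / 2 := by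
    rwa [measureReal_def, measure_toMeasurable]
  have hT0 : 0 ≤ (densityMeasure p).real (toMeasurable (densityMeasure p) S) := measureReal_nonneg
  refine (pi_count_tail (densityMeasure p) n (toMeasurable (densityMeasure p) S)
    (measurableSet_toMeasurable _ _) (1 / 2) (13 / 20 * (δ / 2)) (δ * n / 2) (by nlinarith) _
    fun x hx => ?_).trans (Real.exp_le_exp.2 ?_)
  · have h1 : δ * n ≤ ({a | x a ∈ S}.ncard : ℝ) := hx
    have h2 : ({a | x a ∈ S}.ncard : ℝ) ≤
        {a | x a ∈ toMeasurable (densityMeasure p) S}.ncard := Nat.cast_le.2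
      (ncard_le_ncard (fun a ha => subset_toMeasurable (densityMeasure p) S ha) (toFinite _))
    linarith
  · have : 0 ≤ n * δ := by positivity
    linarith

theorem one_sub_le_measure_roughlyIdentified (hd : 0 < d) (hp : IsBoundedDensity p)
    (hcont : Continuous p) (i : Fin M.m) {K : Pt d → ℝ} {δ ε h C₂ : ℝ}
    (hN : M.NoisyAssumptions i δ ε)
    (hkde : ∃ N : ℕ, ∀ n : ℕ, N ≤ n →
      (sampleLaw p n).real {x | ∃ a, ε ≤ |kde K h x (x a) - p (x a)|} ≤
        Real.exp (-(C₂ * n * h ^ d * ε ^ 2))) :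
    ∃ N : ℕ, 2 ≤ N ∧ ∀ n : ℕ, N ≤ n → ∀ k : ℕ, M.NeighbourBounds i n k →
      ∀ e, M.Attainable i n k e → e ≤ (n : ℝ) * δ / 8 → e ≤ C₂ * n * h ^ d * ε ^ 2 →
        1 - ((M.m : ℝ) + 7) * Real.exp (-e) ≤
          (sampleLaw p n).real {x | RoughlyIdentified M.C i x
            (tildeVertices K h k (M.t - ε) δ x) (tildeSymGraph K h k (M.t - ε) δ x)} := by
  have := hp.isProbabilityMeasure
  obtain ⟨hδ, hε, hεt, hδC, hstrip, hcover⟩ := hN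
  obtain ⟨N₁, hN₁⟩ := M.exists_forall_eq_zero_or_le hd hp i ((20 * (d : ℝ)) ^ d) (by positivity)
  obtain ⟨N₂, hN₂⟩ := hkde
  -- By continuity the closure in `levelSet` adds no points, so the density is at least `t`
  -- everywhere on the clusters.
  have hlev : ∀ x ∈ levelSet p M.t, M.t ≤ p x := fun x hx => by
    have hcl : IsClosed {x | M.t ≤ p x} := isClosed_le continuous_const hcont
    rw [levelSet, hcl.closure_eq] at hx
    exact hx
  refine ⟨max (max N₁ N₂) 2, le_max_right _ _, fun n hn k hk e he he₂ he₃ => ?_⟩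
  have hn2 : 2 ≤ n := (le_max_right _ _).trans hn
  have hn12 : max N₁ N₂ ≤ n := (le_max_left _ _).trans hn
  have : IsProbabilityMeasure (sampleLaw p n) := by unfold sampleLaw; infer_instance
  rcases hN₁ n ((le_max_left _ _).trans hn12) k hk with rfl | hkR
  · have h1 : e ≤ 0 := by simpa using he.2
    have h2 : 1 ≤ Real.exp (-e) := Real.one_le_exp (by linarith)
    have h3 : (0 : ℝ) ≤ M.m := Nat.cast_nonneg _
    refine le_trans ?_ measureReal_nonneg
    nlinarith
  refine one_sub_le_measureReal (B := {x | M.SparseAt k x} ∪ {x | ¬ ∀ a b, x a ∈ M.C i →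
    x b ∈ M.C i → (innerGraph (M.C i) k x).Reachable a b} ∪
    {x | ∃ a, ε ≤ |kde K h x (x a) - p (x a)|} ∪ {x | ({a | x a ∈ M.C i}.ncard : ℝ) < δ * n} ∪
    {x | δ * n ≤ ({a | x a ∈ ⋃ j, (enlarged p M.t (M.C j) (2 * ε) \ M.C j)}.ncard : ℝ)}) ?_ ?_
  · refine Filter.Eventually.of_forall fun x hx => ?_
    simp only [mem_union, not_or] at hx
    obtain ⟨⟨⟨⟨h1, h2⟩, h3⟩, h4⟩, h5⟩ := hx
    exact M.roughlyIdentified_of_events hlev i hε hεt hcover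
      (fun a => not_le.1 fun hcon => h3 ⟨a, hcon⟩) h1 (not_not.1 h2) (not_lt.1 h4) (not_le.1 h5)
  -- The five events contribute `m`, `2`, `1`, `1` and `1` times `exp (-e)`, which is within `m +
  -- 7`.
  · refine (measureReal_union_le _ _).trans (le_trans (add_le_add ((measureReal_union_le _ _).trans
      (add_le_add ((measureReal_union_le _ _).trans (add_le_add (measureReal_union_le _ _)
        le_rfl)) le_rfl)) le_rfl) ?_)
    have h1 := M.measure_sparseAt_le hp i hn2 hk
    have h2 := M.measure_not_connected_le hd hp i
      (Filter.Eventually.of_forall hlev) hn2 hk hkR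
    have h3 := hN₂ n ((le_max_right _ _).trans hn12)
    have h4 := M.measure_few_in_cluster_le hp i hδ hδC n
    have h5 := measure_many_in_strips_le hp hδ hstrip n
    have g1 := mul_le_mul_of_nonneg_left (Real.exp_le_exp.2 (neg_le_neg he.1))
      (Nat.cast_nonneg (α := ℝ) M.m)
    have g2 := Real.exp_le_exp.2 (neg_le_neg he.2)
    have g3 := Real.exp_le_exp.2 (neg_le_neg he₂)
    have g4 := Real.exp_le_exp.2 (neg_le_neg he₃)
    have g5 := Real.exp_pos (-e)
    linarith

end ClusterModel

end KNNCluster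

/-! ### Assembly of the three statements -/

theorem theorem2 (d : ℕ) (hd : 0 < d) (p : KNNCluster.Pt d → ℝ)
    (hp : KNNCluster.IsBoundedDensity p) :
    -- the number of neighbours with the best exponent, and the value of that exponent
    (∀ (M : KNNCluster.ClusterModel p) (i : Fin M.m) (n : ℕ), 2 ≤ n →
      M.exponent i n (M.kOpt i n) = ((n : ℝ) - 1) * M.OmegaNoiseFree i ∧
      ∀ k : ℝ, k ≠ M.kOpt i n → M.exponent i n k < M.exponent i n (M.kOpt i n)) ∧
    -- the noise-free case
    (∀ M : KNNCluster.ClusterModel p, M.NoiseFree → ∀ i : Fin M.m, ∃ N : ℕ, ∀ n : ℕ, N ≤ n →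
      (∀ k : ℕ, M.NeighbourBounds i n k →
        1 - ((M.m : ℝ) + 2) * Real.exp (-(M.exponent i n k)) ≤
          (KNNCluster.sampleLaw p n).real
            {x | KNNCluster.Identified M.C i x (KNNCluster.symGraph k x)}) ∧
      ∀ k : ℕ, k = ⌊M.kOpt i n⌋₊ → M.NeighbourBounds i n k →
        1 - ((M.m : ℝ) + 2) * Real.exp (-(((n : ℝ) - 1) * M.OmegaNoiseFree i)) ≤
          (KNNCluster.sampleLaw p n).real
            {x | KNNCluster.Identified M.C i x (KNNCluster.symGraph k x)}) ∧
    -- the noisy case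
    (KNNCluster.IsC3Bounded p → ∀ K : KNNCluster.Pt d → ℝ, KNNCluster.IsKernel K →
      ∃ C₁ C₂ : ℝ, 0 < C₁ ∧ 0 < C₂ ∧
        ∀ (M : KNNCluster.ClusterModel p) (i : Fin M.m) (δ ε h : ℝ),
          M.NoisyAssumptions i δ ε → 0 < h → h ^ 2 ≤ C₁ * ε → ∃ N : ℕ, ∀ n : ℕ, N ≤ n →
          (∀ k : ℕ, M.NeighbourBounds i n k →
            1 - ((M.m : ℝ) + 7) * Real.exp (-(min (min (M.exponent i n k) ((n : ℝ) * δ / 8))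
                (C₂ * n * h ^ d * ε ^ 2))) ≤
              (KNNCluster.sampleLaw p n).real
                {x | KNNCluster.RoughlyIdentified M.C i x
                  (KNNCluster.tildeVertices K h k (M.t - ε) δ x)
                  (KNNCluster.tildeSymGraph K h k (M.t - ε) δ x)}) ∧
          ∀ k : ℕ, k = ⌊M.kOpt i n⌋₊ → M.NeighbourBounds i n k →
            1 - ((M.m : ℝ) + 7) *
                Real.exp (-(((n : ℝ) - 1) * M.OmegaNoisy i n δ h ε C₂)) ≤
              (KNNCluster.sampleLaw p n).real
                {x | KNNCluster.RoughlyIdentified M.C i x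
                  (KNNCluster.tildeVertices K h k (M.t - ε) δ x)
                  (KNNCluster.tildeSymGraph K h k (M.t - ε) δ x)}) := by
  refine ⟨fun M i n hn => ⟨M.exponent_eq_kOpt hp i hn, fun k hk => M.exponent_lt_kOpt hp i hn hk⟩,
    fun M hM i => ?_, fun hC K hK => ?_⟩
  · obtain ⟨N, hN2, hN⟩ := M.one_sub_le_measure_identified hd hp hM i
    exact ⟨N, fun n hn => ⟨fun k hk => hN n hn k hk _ (M.attainable_exponent hp i n k),
      fun k hkf hk => hN n hn k hk _ (M.attainable_floor hp i (hN2.trans hn) hkf)⟩⟩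
  · obtain ⟨B, hB⟩ := hp.bounded
    obtain ⟨C₁, C₂, hC₁, hC₂, hkde⟩ := KNNCluster.kde_concentration hp hC hK hB
    refine ⟨C₁, C₂, hC₁, hC₂, fun M i δ ε h hnoisy hh hhε => ?_⟩
    -- This bound on `ε` by the supremum bound of `p` allows `C₁` and `C₂` to be chosen before the
    -- cluster model.
    have hεB : ε ≤ B := by
      have h1 := M.two_mul_epsTilde_lt hd hp i
      have h2 := M.t_le_pMax hp i
      have h3 : M.pMax i ≤ B := csSup_le ((M.C_nonempty i).image p) (by
        rintro _ ⟨y, -, rfl⟩; exact hB y)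
      linarith [hnoisy.2.1, hnoisy.2.2.1, M.epsTilde_pos]
    obtain ⟨N, hN2, hN⟩ := M.one_sub_le_measure_roughlyIdentified hd hp hC.1.continuous i hnoisy
      (hkde ε h hnoisy.2.1 hεB hh hhε)
    refine ⟨N, fun n hn => ⟨fun k hk => ?_, fun k hkf hk => ?_⟩⟩
    · have ha := M.attainable_exponent hp i n k
      exact hN n hn k hk _
        ⟨((min_le_left _ _).trans (min_le_left _ _)).trans ha.1,
          ((min_le_left _ _).trans (min_le_left _ _)).trans ha.2⟩
        ((min_le_left _ _).trans (min_le_right _ _)) (min_le_right _ _)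
    · have hn2 := hN2.trans hn
      have hn' : (0 : ℝ) < (n : ℝ) - 1 := by
        have : (2 : ℝ) ≤ n := by exact_mod_cast hn2
        linarith
      have ha := M.attainable_floor hp i hn2 hkf
      have h1 : ((n : ℝ) - 1) * M.OmegaNoisy i n δ h ε C₂ ≤ ((n : ℝ) - 1) * M.OmegaNoiseFree i :=
        mul_le_mul_of_nonneg_left ((min_le_left _ _).trans (min_le_left _ _)) hn'.le
      refine hN n hn k hk _ ⟨h1.trans ha.1, h1.trans ha.2⟩ ?_ ?_
      · refine (mul_le_mul_of_nonneg_left ((min_le_left _ _).trans (min_le_right _ _))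
          hn'.le).trans (le_of_eq ?_)
        field_simp
      · refine (mul_le_mul_of_nonneg_left (min_le_right _ _) hn'.le).trans (le_of_eq ?_)
        field_simp
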